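/- Let $\mathcal G$ be a locally compact, not necessarily Hausdorff, étale groupoid: a groupoid with a locally compact topology such that the groupoid operations are continuous, the unit space $\mathcal G^{(0)}\subset\mathcal G$ is locally compact Hausdorff in the relative topology, and the range and source maps $r,s\colon\mathcal G\to\mathcal G^{(0)}$ are local homeomorphisms. Write $\mathcal G_x=s^{-1}(x)$, $\mathcal G^x=r^{-1}(x)$ and $\mathcal G_x^x=\mathcal G_x\cap\mathcal G^x$ for $x\in\mathcal G^{(0)}$. Let $C_c(\mathcal G)$ be the linear span, in the space of all complex functions on $\mathcal G$, of the extensions by zero of the continuous compactly supported functions on open Hausdorff subsets of $\mathcal G$; it is a $*$-algebra with the convolution product $(f_1*f_2)(g)=\sum_{h\in\mathcal G^{r(g)}}f_1(h)f_2(h^{-1}g)$ and the involution $f^*(g)=\overline{f(g^{-1})}$. For $x\in\mathcal G^{(0)}$ let $\rho_x$ be the representation of $C_c(\mathcal G)$ on $\ell^2(\mathcal G_x)$ given by $$(\rho_x(f)\xi)(g)=\sum_{h\in\mathcal G^{r(g)}}f(h)\,\xi(h^{-1}g),$$ and let $C^*_r(\mathcal G)$ be the completion of $C_c(\mathcal G)$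 with respect to the norm $\|f\|_r=\sup_{x\in\mathcal G^{(0)}}\|\rho_x(f)\|$; we use the same symbol $\rho_x$ for the extension to $C^*_r(\mathcal G)$. A representation $\pi$ of a C$^*$-algebra is weakly contained in a representation $\sigma$ if $\ker\sigma\subset\ker\pi$. An open bisection is an open subset of $\mathcal G$ on which $r$ and $s$ are injective. Let $Y\subset\mathcal G^{(0)}$ be a $\mathcal G$-invariant subset and let $x\in(\mathcal G^{(0)}\cap\bar Y)\setminus Y$. Assume that for every finite set of distinct nontrivial cyclic subgroups $G_1,\dots,G_n$ of $\mathcal G_x^x$ we have $$\sum_{k=1}^n\frac1{|G_k|}<1\qquad(\text{with } 1/|G_k|=0 \text{ if } G_k \text{ is infinite}).$$ Then $\rho_x$ is weakly contained in $\bigoplus_{y\in Y}\rho_y$ if and only if the following condition is **not** satisfied: (*) for some $n\ge1$, there are elements $g_1,\dots,g_n\in\mathcal G_x^x\setminus\{x\}$, open bisections $U_1,\dots,U_n$ with $g_k\in U_k$ for all $k$, and a neighbourhood $U$ of $x$ in $\mathcal G^{(0)}$ such that $Y\cap U\subset U_1\cup\dots\cup U_n$. Moreover, (*) is not satisfied if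 and only if there is a net in $Y$ such that $x$ is its unique accumulation point in $\mathcal G_x^x$. -/

import Mathlib

universe u v

noncomputable section

namespace EtaleGroupoid

set_option linter.unusedSectionVars false

open Filter Topology
open scoped ENNReal

/-- A groupoid, given by its set `G` of arrows, with units identified with identity arrows.  The
product `g * h` is meaningful exactly when `source g = range h`; the laws constrain it only for
such pairs, and its values on other pairs are irrelevant in everything below. -/
class ArrowGroupoid (G : Type u) extends Mul G, Inv G where
  source : G → G
  range : G → G
  source_source (g : G) : source (source g) = source g
  range_source (g : G) : range (source g) = source g
  source_range (g : G) : source (range g) = range g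
  range_range (g : G) : range (range g) = range g
  source_mul (g h : G) (hgh : source g = range h) : source (g * h) = source h
  range_mul (g h : G) (hgh : source g = range h) : range (g * h) = range g
  assoc (g h k : G) (hgh : source g = range h) (hhk : source h = range k) :
    (g * h) * k = g * (h * k)
  mul_source (g : G) : g * source g = g
  range_mul_self (g : G) : range g * g = g
  source_inv (g : G) : source g⁻¹ = range g
  range_inv (g : G) : range g⁻¹ = source g
  inv_mul_self (g : G) : g⁻¹ * g = source g
  mul_inv_self (g : G) : g * g⁻¹ = range g

open ArrowGroupoid

/-- The unit space `G⁽⁰⁾ ⊆ G`. -/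
def UnitSpace (G : Type u) [ArrowGroupoid G] : Type u := {x : G // source x = x}

section Algebraic
variable {G : Type u} [ArrowGroupoid G]

instance : CoeOut (UnitSpace G) G := ⟨Subtype.val⟩
instance [TopologicalSpace G] : TopologicalSpace (UnitSpace G) := instTopologicalSpaceSubtype

/-- The source map `s : G → G⁽⁰⁾`. -/
def src (g : G) : UnitSpace G := ⟨source g, source_source g⟩
/-- The range map `r : G → G⁽⁰⁾`. -/
def rng (g : G) : UnitSpace G := ⟨range g, source_range g⟩

theorem UnitSpace.range_eq (x : UnitSpace G) : range (x : G) = x := by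
  have h := range_source (x : G)
  rwa [x.2] at h

theorem src_mul {g h : G} (hgh : src g = rng h) : src (g * h) = src h :=
  Subtype.ext (source_mul g h (congrArg Subtype.val hgh))
theorem rng_mul {g h : G} (hgh : src g = rng h) : rng (g * h) = rng g :=
  Subtype.ext (range_mul g h (congrArg Subtype.val hgh))
theorem src_inv (g : G) : src g⁻¹ = rng g := Subtype.ext (source_inv g)
theorem rng_inv (g : G) : rng g⁻¹ = src g := Subtype.ext (range_inv g)
theorem src_coe (x : UnitSpace G) : src (x : G) = x := Subtype.ext x.2
theorem rng_coe (x : UnitSpace G) : rng (x : G) = x := Subtype.ext x.range_eq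

theorem range_of_rng {g : G} {x : UnitSpace G} (h : rng g = x) : range g = x :=
  congrArg Subtype.val h
theorem source_of_src {g : G} {x : UnitSpace G} (h : src g = x) : source g = x :=
  congrArg Subtype.val h

theorem mul_assoc_of {g h k : G} (h₁ : src g = rng h) (h₂ : src h = rng k) :
    (g * h) * k = g * (h * k) :=
  assoc g h k (congrArg Subtype.val h₁) (congrArg Subtype.val h₂)

/-- The isotropy group `G_x^x = G_x ∩ G^x`. -/
def Isotropy (x : UnitSpace G) : Type u := {g : G // src g = x ∧ rng g = x}
instance (x : UnitSpace G) : CoeOut (Isotropy x) G := ⟨Subtype.val⟩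

instance (x : UnitSpace G) : Group (Isotropy x) where
  mul g h := ⟨g.1 * h.1, by
    have e : src g.1 = rng h.1 := g.2.1.trans h.2.2.symm
    exact ⟨(src_mul e).trans h.2.1, (rng_mul e).trans g.2.2⟩⟩
  one := ⟨x, src_coe x, rng_coe x⟩
  inv g := ⟨g.1⁻¹, (src_inv g.1).trans g.2.2, (rng_inv g.1).trans g.2.1⟩
  mul_assoc g h k := Subtype.ext
    (mul_assoc_of (g.2.1.trans h.2.2.symm) (h.2.1.trans k.2.2.symm))
  one_mul g := Subtype.ext (by
    have h := range_mul_self g.1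
    rwa [show range g.1 = x.1 from congrArg Subtype.val g.2.2] at h)
  mul_one g := Subtype.ext (by
    have h := mul_source g.1
    rwa [show source g.1 = x.1 from congrArg Subtype.val g.2.1] at h)
  inv_mul_cancel g := Subtype.ext
    ((inv_mul_self g.1).trans (congrArg Subtype.val g.2.1))

/-- `G_x = s⁻¹(x)`. -/
def SourceFiber (x : UnitSpace G) : Type u := {g : G // src g = x}
/-- `G^x = r⁻¹(x)`. -/
def RangeFiber (x : UnitSpace G) : Type u := {g : G // rng g = x}



theorem src_div {x : UnitSpace G} (g k : SourceFiber x) : src g.1 = rng (k.1)⁻¹ := by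
  rw [rng_inv, g.2, k.2]

theorem src_inv_mul {x : UnitSpace G} (g : SourceFiber x) (h : RangeFiber (rng g.1)) :
    src (h.1⁻¹ * g.1) = x := by
  rw [src_mul (by rw [src_inv, h.2]), g.2]

/-- For `g ∈ G_x`, the bijection `h ↦ h⁻¹ g` from `G^{r(g)}` onto `G_x`. -/
def fiberEquiv {x : UnitSpace G} (g : SourceFiber x) : RangeFiber (rng g.1) ≃ SourceFiber x where
  toFun h := ⟨h.1⁻¹ * g.1, src_inv_mul g h⟩
  invFun k := ⟨g.1 * k.1⁻¹, rng_mul (src_div g k)⟩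
  left_inv h := by
    apply Subtype.ext
    have h1 : src h.1⁻¹ = rng g.1 := by rw [src_inv, h.2]
    have h2 : h.1 * (h.1⁻¹ * g.1) = g.1 := by
      rw [← mul_assoc_of (rng_inv h.1).symm h1, mul_inv_self, range_of_rng h.2]
      exact range_mul_self g.1
    have h3 : rng (h.1⁻¹ * g.1) = src h.1 := by rw [rng_mul h1, rng_inv]
    change g.1 * (h.1⁻¹ * g.1)⁻¹ = h.1
    conv_lhs => enter [1]; rw [← h2]
    rw [mul_assoc_of h3.symm (rng_inv _).symm, mul_inv_self, range_of_rng h3]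
    exact mul_source h.1
  right_inv k := by
    apply Subtype.ext
    have h1 : src g.1 = rng k.1⁻¹ := src_div g k
    have h2 : (g.1 * k.1⁻¹) * k.1 = g.1 := by
      rw [mul_assoc_of h1 (src_inv k.1), inv_mul_self, source_of_src k.2, ← source_of_src g.2]
      exact mul_source g.1
    have h3 : src (g.1 * k.1⁻¹) = rng k.1 := by rw [src_mul h1, src_inv]
    change (g.1 * k.1⁻¹)⁻¹ * g.1 = k.1
    conv_lhs => enter [2]; rw [← h2]
    rw [← mul_assoc_of (src_inv _) h3, inv_mul_self, source_of_src h3]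
    exact range_mul_self k.1

/-- The Hilbert space `ℓ²(G_x)`. -/
abbrev HilbertFiber (x : UnitSpace G) : Type u := lp (fun _ : SourceFiber x => ℂ) 2

/-- The formula `(ρ_x(f)ξ)(g) = ∑_{h ∈ G^{r(g)}} f(h) ξ(h⁻¹g)`. -/
def rhoFun (x : UnitSpace G) (f : G → ℂ) (ξ : SourceFiber x → ℂ) (g : SourceFiber x) : ℂ :=
  ∑' h : RangeFiber (rng g.1), f h.1 * ξ ⟨h.1⁻¹ * g.1, src_inv_mul g h⟩

theorem rhoFun_eq (x : UnitSpace G) (f : G → ℂ) (ξ : SourceFiber x → ℂ) (g : SourceFiber x) :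
    rhoFun x f ξ g = ∑' k : SourceFiber x, f (g.1 * k.1⁻¹) * ξ k := by
  rw [rhoFun, ← (fiberEquiv g).symm.tsum_eq]
  refine tsum_congr fun k => ?_
  congr 2
  exact (fiberEquiv g).apply_symm_apply k

end Algebraic

section Schur
variable {ι : Type u}

theorem schur_bound (k : ι → ι → ℂ) (N : ℕ) (M : ℝ) (hM : ∀ i j, ‖k i j‖ ≤ M)
    (hrow : ∀ i, {j | k i j ≠ 0}.encard ≤ N) (hcol : ∀ j, {i | k i j ≠ 0}.encard ≤ N)
    (ξ : lp (fun _ : ι => ℂ) 2) (T : Finset ι) :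
    ∑ i ∈ T, ‖∑' j, k i j * ξ j‖ ^ 2 ≤ (N * M * ‖ξ‖) ^ 2 := by
  classical
  have hfin : ∀ i, {j | k i j ≠ 0}.Finite := fun i =>
    Set.finite_of_encard_le_coe (hrow i)
  let S : ι → Finset ι := fun i => (hfin i).toFinset
  have hS : ∀ i, (S i).card ≤ N := fun i => by
    have := hrow i
    rw [(hfin i).encard_eq_coe_toFinset_card] at this
    exact_mod_cast this
  have hmem : ∀ i j, j ∈ S i ↔ k i j ≠ 0 := fun i j => by simp [S]
  have hsum : ∀ i, ∑' j, k i j * ξ j = ∑ j ∈ S i, k i j * ξ j := fun i =>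
    tsum_eq_sum fun j hj => by
      rw [hmem, not_not] at hj
      rw [hj, zero_mul]
  have h1 : ∀ i, ‖∑' j, k i j * ξ j‖ ^ 2 ≤ N * M ^ 2 * ∑ j ∈ S i, ‖ξ j‖ ^ 2 := fun i => by
    rw [hsum]
    calc ‖∑ j ∈ S i, k i j * ξ j‖ ^ 2 ≤ (∑ j ∈ S i, M * ‖ξ j‖) ^ 2 := by
          gcongr
          refine (norm_sum_le _ _).trans (Finset.sum_le_sum fun j _ => ?_)
          rw [norm_mul]
          gcongr
          exact hM i j
      _ ≤ (S i).card * ∑ j ∈ S i, (M * ‖ξ j‖) ^ 2 := sq_sum_le_card_mul_sum_sq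
      _ ≤ N * ∑ j ∈ S i, (M * ‖ξ j‖) ^ 2 := by
          gcongr
          exact hS i
      _ = N * M ^ 2 * ∑ j ∈ S i, ‖ξ j‖ ^ 2 := by
          simp_rw [mul_pow, ← Finset.mul_sum, mul_assoc]
  let J : Finset ι := T.biUnion S
  have h2 : ∑ i ∈ T, ∑ j ∈ S i, ‖ξ j‖ ^ 2 ≤ N * ∑ j ∈ J, ‖ξ j‖ ^ 2 := by
    have : ∀ i ∈ T, ∑ j ∈ S i, ‖ξ j‖ ^ 2 = ∑ j ∈ J, if k i j ≠ 0 then ‖ξ j‖ ^ 2 else 0 := by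
      intro i hi
      rw [← Finset.sum_filter]
      refine Finset.sum_congr ?_ fun _ _ => rfl
      ext j
      simp only [Finset.mem_filter, J, Finset.mem_biUnion, hmem]
      exact ⟨fun h => ⟨⟨i, hi, h⟩, h⟩, fun h => h.2⟩
    rw [Finset.sum_congr rfl this, Finset.sum_comm, Finset.mul_sum]
    refine Finset.sum_le_sum fun j _ => ?_
    rw [← Finset.sum_filter, Finset.sum_const, nsmul_eq_mul]
    gcongr
    have h3 : ((T.filter fun i => k i j ≠ 0 : Finset ι) : Set ι).encard ≤ N :=
      (Set.encard_le_encard (fun i hi => by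
        have := Finset.mem_coe.1 hi
        exact (Finset.mem_filter.1 this).2)).trans (hcol j)
    rw [Set.encard_coe_eq_coe_finsetCard] at h3
    exact_mod_cast h3
  have h4 : ∑ j ∈ J, ‖ξ j‖ ^ 2 ≤ ‖ξ‖ ^ 2 := by
    have := lp.sum_rpow_le_norm_rpow (p := 2) (by norm_num) ξ J
    simpa using this
  calc ∑ i ∈ T, ‖∑' j, k i j * ξ j‖ ^ 2 ≤ ∑ i ∈ T, N * M ^ 2 * ∑ j ∈ S i, ‖ξ j‖ ^ 2 :=
        Finset.sum_le_sum fun i _ => h1 i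
    _ = N * M ^ 2 * ∑ i ∈ T, ∑ j ∈ S i, ‖ξ j‖ ^ 2 := by rw [Finset.mul_sum]
    _ ≤ N * M ^ 2 * (N * ‖ξ‖ ^ 2) := by
        gcongr
        exact h2.trans (by gcongr)
    _ = (N * M * ‖ξ‖) ^ 2 := by ring

end Schur

section Etale
variable (G : Type u) [TopologicalSpace G] [ArrowGroupoid G]

/-- A locally compact, not necessarily Hausdorff, étale groupoid. -/
class IsLocallyCompactEtale : Prop where
  locallyCompactSpace : LocallyCompactSpace G
  continuous_inv : Continuous fun g : G => g⁻¹
  continuousOn_mul : ContinuousOn (fun p : G × G => p.1 * p.2) {p | src p.1 = rng p.2}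
  unitSpace_t2 : T2Space (UnitSpace G)
  unitSpace_locallyCompact : LocallyCompactSpace (UnitSpace G)
  isLocalHomeomorph_src : IsLocalHomeomorph (src : G → UnitSpace G)
  isLocalHomeomorph_rng : IsLocalHomeomorph (rng : G → UnitSpace G)

/-- `C_c(G)`: the linear span, inside the space of all functions `G → ℂ`, of the extensions by zero
of the continuous compactly supported functions on open Hausdorff subsets `V` of `G`. -/
def Cc : Submodule ℂ (G → ℂ) :=
  Submodule.span ℂ {f | ∃ V : Set G, IsOpen V ∧ T2Space V ∧
    Continuous (V.domRestrict f) ∧ HasCompactSupport (V.domRestrict f) ∧ ∀ g ∉ V, f g = 0}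

variable {G}

/-- `f` is bounded by `M` and has at most `N` nonzero values on every source and range fibre. -/
structure FiberBound (f : G → ℂ) (N : ℕ) (M : ℝ) : Prop where
  norm_le (g : G) : ‖f g‖ ≤ M
  src_le (x : UnitSpace G) : {g | src g = x ∧ f g ≠ 0}.encard ≤ N
  rng_le (x : UnitSpace G) : {g | rng g = x ∧ f g ≠ 0}.encard ≤ N

theorem FiberBound.nonneg {f : G → ℂ} {N : ℕ} {M : ℝ} (h : FiberBound f N M) (x : UnitSpace G) :
    0 ≤ M := (norm_nonneg _).trans (h.norm_le x)

theorem FiberBound.add {f₁ f₂ : G → ℂ} {N₁ N₂ : ℕ} {M₁ M₂ : ℝ} (h₁ : FiberBound f₁ N₁ M₁)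
    (h₂ : FiberBound f₂ N₂ M₂) : FiberBound (f₁ + f₂) (N₁ + N₂) (M₁ + M₂) := by
  have key : ∀ P : G → Prop, {g | P g ∧ (f₁ + f₂) g ≠ 0} ⊆
      {g | P g ∧ f₁ g ≠ 0} ∪ {g | P g ∧ f₂ g ≠ 0} := by
    rintro P g ⟨hg, hne⟩
    by_cases h : f₁ g = 0
    · exact Or.inr ⟨hg, fun h' => hne (by simp [h, h'])⟩
    · exact Or.inl ⟨hg, h⟩
  refine ⟨fun g => (norm_add_le _ _).trans (add_le_add (h₁.norm_le g) (h₂.norm_le g)),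
    fun x => ?_, fun x => ?_⟩
  · refine ((Set.encard_le_encard (key _)).trans (Set.encard_union_le _ _)).trans ?_
    push_cast
    exact add_le_add (h₁.src_le x) (h₂.src_le x)
  · refine ((Set.encard_le_encard (key _)).trans (Set.encard_union_le _ _)).trans ?_
    push_cast
    exact add_le_add (h₁.rng_le x) (h₂.rng_le x)

theorem FiberBound.smul {f : G → ℂ} {N : ℕ} {M : ℝ} (h : FiberBound f N M) (c : ℂ) :
    FiberBound (c • f) N (‖c‖ * M) := by
  refine ⟨fun g => ?_, fun x => ?_, fun x => ?_⟩
  · simp only [Pi.smul_apply, norm_smul]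
    gcongr
    exact h.norm_le g
  · refine (Set.encard_le_encard fun g hg => ?_).trans (h.src_le x)
    exact ⟨hg.1, fun h0 => hg.2 (by simp [h0])⟩
  · refine (Set.encard_le_encard fun g hg => ?_).trans (h.rng_le x)
    exact ⟨hg.1, fun h0 => hg.2 (by simp [h0])⟩

theorem encard_le_of_cover (p : G → UnitSpace G) (W : G → Set G) (t : Finset G)
    (hinj : ∀ g, Set.InjOn p (W g)) (A : Set G) (hA : A ⊆ ⋃ g ∈ t, W g) (x : UnitSpace G)
    (hx : ∀ g ∈ A, p g = x) : A.encard ≤ t.card := by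
  choose! c hc using fun g (hg : g ∈ A) => Set.mem_iUnion₂.1 (hA hg)
  have hinjc : Set.InjOn c A := fun g hg h hh e => by
    obtain ⟨-, h1⟩ := hc g hg
    obtain ⟨-, h2⟩ := hc h hh
    rw [← e] at h2
    exact hinj _ h1 h2 ((hx g hg).trans (hx h hh).symm)
  rw [← hinjc.encard_image, ← Set.encard_coe_eq_coe_finsetCard]
  refine Set.encard_le_encard ?_
  rintro _ ⟨g, hg, rfl⟩
  exact (hc g hg).1

theorem exists_fiberBound [IsLocallyCompactEtale G] (f : Cc G) :
    ∃ (N : ℕ) (M : ℝ), FiberBound (f : G → ℂ) N M := by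
  obtain ⟨f, hf⟩ := f
  change ∃ (N : ℕ) (M : ℝ), FiberBound f N M
  induction hf using Submodule.span_induction with
  | zero => exact ⟨0, 0, by simp, by simp, by simp⟩
  | add f₁ f₂ _ _ h₁ h₂ =>
    obtain ⟨N₁, M₁, h₁⟩ := h₁
    obtain ⟨N₂, M₂, h₂⟩ := h₂
    exact ⟨_, _, h₁.add h₂⟩
  | smul c f _ h =>
    obtain ⟨N, M, h⟩ := h
    exact ⟨_, _, h.smul c⟩
  | mem f hf =>
    obtain ⟨V, -, -, hcont, hsupp, hzero⟩ := hf
    obtain ⟨C, hC⟩ := hsupp.exists_bound_of_continuous hcont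
    have hK : IsCompact (Subtype.val '' tsupport (V.domRestrict f)) :=
      IsCompact.image hsupp continuous_subtype_val
    have hsub : ∀ g, f g ≠ 0 → g ∈ Subtype.val '' tsupport (V.domRestrict f) := fun g hg => by
      have hgV : g ∈ V := by
        by_contra h
        exact hg (hzero g h)
      exact ⟨⟨g, hgV⟩, subset_tsupport _ hg, rfl⟩
    have hW : ∀ g : G, ∃ W ∈ 𝓝 g, Set.InjOn (src : G → UnitSpace G) W ∧
        Set.InjOn (rng : G → UnitSpace G) W := fun g => by
      obtain ⟨e, he, h1⟩ := IsLocallyCompactEtale.isLocalHomeomorph_src (G := G) g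
      obtain ⟨e', he', h2⟩ := IsLocallyCompactEtale.isLocalHomeomorph_rng (G := G) g
      refine ⟨e.source ∩ e'.source, inter_mem (e.open_source.mem_nhds he)
        (e'.open_source.mem_nhds he'), ?_, ?_⟩
      · rw [h1]
        exact e.injOn.mono Set.inter_subset_left
      · rw [h2]
        exact e'.injOn.mono Set.inter_subset_right
    choose W hWn hWs hWr using hW
    obtain ⟨t, -, ht⟩ := hK.elim_nhds_subcover W fun g _ => hWn g
    refine ⟨t.card, max C 0, fun g => ?_, fun x => ?_, fun x => ?_⟩
    · by_cases hg : g ∈ V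
      · exact (hC ⟨g, hg⟩).trans (le_max_left _ _)
      · simp [hzero g hg]
    · exact encard_le_of_cover src W t hWs _ (fun g hg => ht (hsub g hg.2)) x fun g hg => hg.1
    · exact encard_le_of_cover rng W t hWr _ (fun g hg => ht (hsub g hg.2)) x fun g hg => hg.1

theorem rhoFun_row {f : G → ℂ} {N : ℕ} {M : ℝ} (h : FiberBound f N M) {x : UnitSpace G}
    (g : SourceFiber x) : {k : SourceFiber x | f (g.1 * k.1⁻¹) ≠ 0}.encard ≤ N := by
  have hinj : Function.Injective fun k : SourceFiber x => g.1 * k.1⁻¹ := fun k l e =>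
    (fiberEquiv g).symm.injective (Subtype.ext e)
  rw [← hinj.encard_image]
  refine (Set.encard_le_encard ?_).trans (h.rng_le (rng g.1))
  rintro _ ⟨k, hk, rfl⟩
  exact ⟨rng_mul (src_div g k), hk⟩

theorem rhoFun_col {f : G → ℂ} {N : ℕ} {M : ℝ} (h : FiberBound f N M) {x : UnitSpace G}
    (k : SourceFiber x) : {g : SourceFiber x | f (g.1 * k.1⁻¹) ≠ 0}.encard ≤ N := by
  have hinj : Function.Injective fun g : SourceFiber x => g.1 * k.1⁻¹ := fun g l e => by
    have hc : ∀ g : SourceFiber x, (g.1 * k.1⁻¹) * k.1 = g.1 := fun g => by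
      rw [mul_assoc_of (src_div g k) (src_inv k.1), inv_mul_self, source_of_src k.2,
        ← source_of_src g.2]
      exact mul_source g.1
    apply Subtype.ext
    rw [← hc g, ← hc l]
    exact congrArg (· * k.1) e
  rw [← hinj.encard_image]
  refine (Set.encard_le_encard ?_).trans (h.src_le (rng k.1))
  rintro _ ⟨g, hg, rfl⟩
  exact ⟨(src_mul (src_div g k)).trans (src_inv k.1), hg⟩

theorem rhoFun_bound {f : G → ℂ} {N : ℕ} {M : ℝ} (h : FiberBound f N M) {x : UnitSpace G}
    (ξ : HilbertFiber x) (T : Finset (SourceFiber x)) :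
    ∑ g ∈ T, ‖rhoFun x f ξ g‖ ^ 2 ≤ (N * M * ‖ξ‖) ^ 2 := by
  simp_rw [rhoFun_eq]
  exact schur_bound (fun g k : SourceFiber x => f (g.1 * k.1⁻¹)) N M (fun _ _ => h.norm_le _)
    (rhoFun_row h) (rhoFun_col h) ξ T

theorem rhoFun_memℓp [IsLocallyCompactEtale G] (x : UnitSpace G) (f : Cc G) (ξ : HilbertFiber x) :
    Memℓp (rhoFun x f ξ) 2 := by
  obtain ⟨N, M, h⟩ := exists_fiberBound f
  exact memℓp_gen' (C := (N * M * ‖ξ‖) ^ 2) fun T => by simpa using rhoFun_bound h ξ T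

/-- `ρ_x(f)` as a linear map. -/
def rhoLin [IsLocallyCompactEtale G] (x : UnitSpace G) (f : Cc G) :
    HilbertFiber x →ₗ[ℂ] HilbertFiber x where
  toFun ξ := ⟨rhoFun x f ξ, rhoFun_memℓp x f ξ⟩
  map_add' ξ η := by
    obtain ⟨N, M, h⟩ := exists_fiberBound f
    ext g
    change rhoFun x f (fun k => ξ k + η k) g = rhoFun x f ξ g + rhoFun x f η g
    simp only [rhoFun_eq]
    have hs : ∀ ζ : SourceFiber x → ℂ,
        Summable fun k : SourceFiber x => (f : G → ℂ) (g.1 * k.1⁻¹) * ζ k := fun ζ =>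
      summable_of_hasFiniteSupport ((Set.finite_of_encard_le_coe (rhoFun_row h g)).subset
        fun k hk => left_ne_zero_of_mul hk)
    rw [← (hs ξ).tsum_add (hs η)]
    simp_rw [mul_add]
  map_smul' c ξ := by
    ext g
    change rhoFun x f (fun k => c * ξ k) g = c * rhoFun x f ξ g
    simp only [rhoFun]
    rw [← tsum_mul_left]
    exact tsum_congr fun h => by ring

theorem norm_rhoLin_le [IsLocallyCompactEtale G] (x : UnitSpace G) (f : Cc G) {N : ℕ} {M : ℝ}
    (h : FiberBound (f : G → ℂ) N M) (ξ : HilbertFiber x) : ‖rhoLin x f ξ‖ ≤ N * M * ‖ξ‖ := by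
  have := h.nonneg x
  exact lp.norm_le_of_forall_sum_le (by norm_num) (by positivity) fun T => by
    have h1 := rhoFun_bound h ξ T
    simp only [ENNReal.toReal_ofNat, Real.rpow_ofNat]
    exact h1

/-- The bounded operator `ρ_x(f)` on `ℓ²(G_x)`, for `f ∈ C_c(G)`. -/
def rhoCc [IsLocallyCompactEtale G] (x : UnitSpace G) (f : Cc G) :
    HilbertFiber x →L[ℂ] HilbertFiber x :=
  ⟨rhoLin x f, by
    obtain ⟨N, M, h⟩ := exists_fiberBound f
    exact AddMonoidHomClass.continuous_of_bound (rhoLin x f) _ (norm_rhoLin_le x f h)⟩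

theorem rhoCc_memℓp [IsLocallyCompactEtale G] (f : Cc G) :
    Memℓp (fun x : UnitSpace G => rhoCc x f) ∞ := by
  obtain ⟨N, M, h⟩ := exists_fiberBound f
  refine memℓp_infty ⟨N * M, ?_⟩
  rintro _ ⟨x, rfl⟩
  have := h.nonneg x
  exact ContinuousLinearMap.opNorm_le_bound _ (by positivity) (norm_rhoLin_le x f h)

variable (G)

/-- The C⋆-algebra of bounded families in `∏_x B(ℓ²(G_x))`, with the supremum norm. -/
def OperatorProduct : Type u :=
  lp (fun x : UnitSpace G => HilbertFiber x →L[ℂ] HilbertFiber x) ∞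

instance : NonUnitalCStarAlgebra (OperatorProduct G) :=
  inferInstanceAs
    (NonUnitalCStarAlgebra (lp (fun x : UnitSpace G => HilbertFiber x →L[ℂ] HilbertFiber x) ∞))

variable {G} in
/-- The family `(ρ_x(f))_x`; its norm is `‖f‖_r = sup_x ‖ρ_x(f)‖`. -/
def rhoFamily [IsLocallyCompactEtale G] (f : Cc G) : OperatorProduct G :=
  ⟨fun x => rhoCc x f, rhoCc_memℓp f⟩

/-- The reduced C⋆-algebra `C*_r(G)`.  As `f ↦ (ρ_x(f))_x` is an isometry of `(C_c(G), ‖·‖_r)` into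
`OperatorProduct G` and a homomorphism for convolution and involution, the completion of `C_c(G)`
is the closed `*`-subalgebra generated by the image. -/
def reducedSubalgebra [IsLocallyCompactEtale G] : NonUnitalStarSubalgebra ℂ (OperatorProduct G) :=
  (NonUnitalStarAlgebra.adjoin ℂ (Set.range (rhoFamily (G := G)))).topologicalClosure

def ReducedCStarAlgebra [IsLocallyCompactEtale G] : Type u := reducedSubalgebra G

instance [IsLocallyCompactEtale G] : IsClosed (reducedSubalgebra G : Set (OperatorProduct G)) :=
  NonUnitalStarSubalgebra.isClosed_topologicalClosure _

instance [IsLocallyCompactEtale G] : NonUnitalCStarAlgebra (ReducedCStarAlgebra G) :=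
  inferInstanceAs (NonUnitalCStarAlgebra (reducedSubalgebra G))

variable {G}

/-- The projection of `OperatorProduct G` onto its factor `B(ℓ²(G_x))`. -/
def OperatorProduct.proj (x : UnitSpace G) :
    OperatorProduct G →⋆ₙₐ[ℂ] (HilbertFiber x →L[ℂ] HilbertFiber x) where
  toFun a := a.1 x
  map_smul' _ _ := rfl
  map_zero' := rfl
  map_add' _ _ := rfl
  map_mul' _ _ := rfl
  map_star' _ := rfl

/-- The representation `ρ_x` of `C*_r(G)` on `ℓ²(G_x)`, extending `rhoCc x` on `C_c(G)`. -/
def rho [IsLocallyCompactEtale G] (x : UnitSpace G) :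
    ReducedCStarAlgebra G →⋆ₙₐ[ℂ] (HilbertFiber x →L[ℂ] HilbertFiber x) :=
  (OperatorProduct.proj x).comp (NonUnitalStarSubalgebraClass.subtype (reducedSubalgebra G))

end Etale

section Representations
variable {A : Type u} [NonUnitalCStarAlgebra A]

/-- The Hilbert space direct sum `⊕_i π_i` of representations of a C⋆-algebra. -/
def directSum {ι : Type v} {H : ι → Type u} [∀ i, NormedAddCommGroup (H i)]
    [∀ i, InnerProductSpace ℂ (H i)] [∀ i, CompleteSpace (H i)]
    (π : ∀ i, A →⋆ₙₐ[ℂ] (H i →L[ℂ] H i)) : A →⋆ₙₐ[ℂ] (lp H 2 →L[ℂ] lp H 2) :=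
  have hle : ∀ (a : A) (ξ : lp H 2) (i : ι), ‖π i a (ξ i)‖ ≤ ‖((‖a‖ : ℂ) • ξ) i‖ := fun a ξ i => by
    rw [lp.coeFn_smul, Pi.smul_apply, norm_smul, Complex.norm_real, norm_norm]
    refine ((π i a).le_opNorm _).trans ?_
    gcongr
    exact NonUnitalStarAlgHom.norm_apply_le (π i) a
  let T : A → lp H 2 → lp H 2 := fun a ξ =>
    ⟨fun i => π i a (ξ i), (lp.memℓp ((‖a‖ : ℂ) • ξ)).mono' (hle a ξ)⟩
  have hT : ∀ a ξ, ‖T a ξ‖ ≤ ‖a‖ * ‖ξ‖ := fun a ξ => by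
    have h1 : ‖T a ξ‖ ≤ ‖(‖a‖ : ℂ) • ξ‖ := lp.norm_mono (by norm_num) (hle a ξ)
    rwa [norm_smul, Complex.norm_real, norm_norm] at h1
  { toFun := fun a => LinearMap.mkContinuous
      { toFun := T a
        map_add' := fun ξ η => by
          ext i
          exact map_add (π i a) (ξ i) (η i)
        map_smul' := fun c ξ => by
          ext i
          exact map_smul (π i a) c (ξ i) } ‖a‖ (hT a)
    map_smul' := fun c a => by
      ext ξ i
      change π i (c • a) (ξ i) = c • π i a (ξ i)
      rw [map_smul]
      rfl
    map_zero' := by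
      ext ξ i
      change π i 0 (ξ i) = 0
      rw [map_zero]
      rfl
    map_add' := fun a b => by
      ext ξ i
      change π i (a + b) (ξ i) = π i a (ξ i) + π i b (ξ i)
      rw [map_add]
      rfl
    map_mul' := fun a b => by
      ext ξ i
      change π i (a * b) (ξ i) = π i a (π i b (ξ i))
      rw [map_mul]
      rfl
    map_star' := fun a => by
      rw [ContinuousLinearMap.star_eq_adjoint, ContinuousLinearMap.eq_adjoint_iff]
      intro ξ η
      rw [lp.inner_eq_tsum, lp.inner_eq_tsum]
      refine tsum_congr fun i => ?_
      change inner ℂ (π i (star a) (ξ i)) (η i) = inner ℂ (ξ i) (π i a (η i))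
      rw [map_star, ContinuousLinearMap.star_eq_adjoint, ContinuousLinearMap.adjoint_inner_left] }

/-- A representation `π` of a C⋆-algebra `A` is weakly contained in a representation `σ` of `A` if
`ker σ ⊆ ker π`. -/
def WeaklyContained {H K : Type*} [NormedAddCommGroup H] [InnerProductSpace ℂ H] [CompleteSpace H]
    [NormedAddCommGroup K] [InnerProductSpace ℂ K] [CompleteSpace K]
    (π : A →⋆ₙₐ[ℂ] (H →L[ℂ] H)) (σ : A →⋆ₙₐ[ℂ] (K →L[ℂ] K)) : Prop :=
  ∀ a : A, σ a = 0 → π a = 0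

end Representations

section Criterion
variable {G : Type u} [TopologicalSpace G] [ArrowGroupoid G]

/-- `Y ⊆ G⁽⁰⁾` is `G`-invariant. -/
def GroupoidInvariant (Y : Set (UnitSpace G)) : Prop := ∀ g : G, src g ∈ Y ↔ rng g ∈ Y

/-- An open bisection: an open set on which the source and range maps are injective (hence, in an
étale groupoid, homeomorphisms onto open subsets of `G⁽⁰⁾`). -/
def IsOpenBisection (U : Set G) : Prop :=
  IsOpen U ∧ Set.InjOn (src : G → UnitSpace G) U ∧ Set.InjOn (rng : G → UnitSpace G) U

/-- Near `x`, the set `Y` is covered by finitely many open bisections around nontrivial elements of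
the isotropy group of `x`. -/
def CoveredNear (Y : Set (UnitSpace G)) (x : UnitSpace G) : Prop :=
  ∃ n : ℕ, 1 ≤ n ∧ ∃ (g : Fin n → Isotropy x) (B : Fin n → Set G) (U : Set (UnitSpace G)),
    (∀ k, g k ≠ 1 ∧ IsOpenBisection (B k) ∧ (g k : G) ∈ B k) ∧ U ∈ 𝓝 x ∧
      ∀ y ∈ Y ∩ U, (y : G) ∈ ⋃ k, B k

/-- There is a net in `Y` whose only accumulation point in the isotropy group of `x` (with respect
to the topology of `G`) is `x`. -/
def ExistsNetUniqueAcc (Y : Set (UnitSpace G)) (x : UnitSpace G) : Prop :=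
  ∃ (ι : Type u) (_ : Preorder ι) (_ : IsDirectedOrder ι) (_ : Nonempty ι) (y : ι → UnitSpace G),
    (∀ i, y i ∈ Y) ∧
      ∀ g : Isotropy x, MapClusterPt (g : G) atTop (fun i => (y i : G)) ↔ g = 1

/-- `∑_k 1/|G_k| < 1` for every finite set of distinct nontrivial cyclic subgroups `G_k` of `Γ`.
For infinite `G_k` one has `Nat.card G_k = 0`, so the summand is `0 = 1/∞`. -/
def FewCyclicSubgroups (Γ : Type*) [Group Γ] : Prop :=
  ∀ F : Finset (Subgroup Γ), (∀ C ∈ F, IsCyclic C ∧ C ≠ ⊥) →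
    ∑ C ∈ F, (1 : ℝ) / (Nat.card C : ℝ) < 1

end Criterion

end EtaleGroupoid

end

open EtaleGroupoid

/-! In a non-Hausdorff groupoid, units `y → x` may converge at the same time to nontrivial elements
of the isotropy group of `x`; (*) says that, near `x`, every unit in `Y` lies in one of finitely
many bisections around such elements.

If (*) fails, the sets covered near `x` by finitely many such bisections form a proper ideal, and
the dual filter `l` approaches `x` through `Y` while avoiding every nontrivial isotropy element
(`exists_approachFilter`). Along `l` the vector states `a ↦ ⟨ρ_y(a)δ_y, δ_y⟩` converge to the one at
`x`: this is checked on operators that permute basis vectors up to scalars, whose span is dense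
enough to contain the reduced algebra in its closure. Since `δ_x` is cyclic, an element killed by
all `ρ_y`, `y ∈ Y`, is killed by `ρ_x`. The same filter, written as a net, has `x` as its only
accumulation point in the isotropy group; conversely, such a net contradicts (*) by pigeonhole along
an ultrafilter.

If (*) holds, let `C` run over the distinct cyclic groups generated by the `g_j`, and let `S_C ⊆ C`
be finite. Units close to `x` in `B_j` are close to every chosen power of `g_j`. So the average
`f_C` of bumps on bisections around `S_C` acts there like the bump `f₀` on the unit space, and `∑
f_C* f_C - f₀* f₀` is positive in every `ρ_y`, `y ∈ Y`. At `δ_x` its form equals `∑ 1/|S_C| - 1 <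
0`. Its negative part is killed by all `ρ_y` but not by `ρ_x` (`not_weaklyContained_of_norm_sq_lt`).
-/

noncomputable section
namespace EtaleGroupoid
open Filter Topology ArrowGroupoid
open scoped ENNReal
set_option linter.unusedSectionVars false

/-! ### Open bisections, their sections, and functions supported on them -/

section Bisections
variable {G : Type u} [TopologicalSpace G] [ArrowGroupoid G]

theorem continuous_unitSpace_coe : Continuous (fun y : UnitSpace G => (y : G)) :=
  continuous_subtype_val

theorem UnitSpace.mul_self (y : UnitSpace G) : (y : G) * y = y := by
  have h := mul_source (y : G)
  rwa [y.2] at h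

theorem UnitSpace.inv_coe (y : UnitSpace G) : (y : G)⁻¹ = y := by
  have h1 : range (y : G)⁻¹ = y := (range_inv (y : G)).trans y.2
  have h2 : source (y : G)⁻¹ = y := (source_inv (y : G)).trans y.range_eq
  have h3 := mul_source ((y : G)⁻¹)
  have h4 := inv_mul_self (y : G)
  rw [h2] at h3
  rw [h3] at h4
  exact h4.trans y.2

variable [IsLocallyCompactEtale G]

theorem continuous_src : Continuous (src : G → UnitSpace G) :=
  (IsLocallyCompactEtale.isLocalHomeomorph_src (G := G)).continuous

theorem continuous_rng : Continuous (rng : G → UnitSpace G) :=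
  (IsLocallyCompactEtale.isLocalHomeomorph_rng (G := G)).continuous

theorem isOpenMap_src : IsOpenMap (src : G → UnitSpace G) :=
  (IsLocallyCompactEtale.isLocalHomeomorph_src (G := G)).isOpenMap

instance : T2Space (UnitSpace G) := IsLocallyCompactEtale.unitSpace_t2
instance : LocallyCompactSpace (UnitSpace G) := IsLocallyCompactEtale.unitSpace_locallyCompact

theorem exists_isOpenBisection (g : G) : ∃ B : Set G, IsOpenBisection B ∧ g ∈ B := by
  obtain ⟨e, he, h1⟩ := IsLocallyCompactEtale.isLocalHomeomorph_src (G := G) g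
  obtain ⟨e', he', h2⟩ := IsLocallyCompactEtale.isLocalHomeomorph_rng (G := G) g
  refine ⟨e.source ∩ e'.source, ⟨e.open_source.inter e'.open_source, ?_, ?_⟩, he, he'⟩
  · rw [h1]
    exact e.injOn.mono Set.inter_subset_left
  · rw [h2]
    exact e'.injOn.mono Set.inter_subset_right

theorem IsOpenBisection.mono {B B' : Set G} (hB : IsOpenBisection B) (hB' : IsOpen B')
    (h : B' ⊆ B) : IsOpenBisection B' :=
  ⟨hB', hB.2.1.mono h, hB.2.2.mono h⟩

/-- Openness: for `k` close to a unit `g`, both `k` and its source lie in a bisection around `g` and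
share their source, so they coincide. -/
theorem isOpenBisection_units : IsOpenBisection {g : G | source g = g} := by
  refine ⟨isOpen_iff_mem_nhds.2 fun g hg => ?_, ?_, ?_⟩
  · obtain ⟨B, hB, hgB⟩ := exists_isOpenBisection g
    have h : Continuous fun k : G => ((src k : UnitSpace G) : G) :=
      continuous_unitSpace_coe.comp continuous_src
    have hg' : ((src g : UnitSpace G) : G) ∈ B := by
      change source g ∈ B
      rwa [show source g = g from hg]
    filter_upwards [hB.1.mem_nhds hgB, h.continuousAt.preimage_mem_nhds (hB.1.mem_nhds hg')]
      with k hk hk'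
    exact hB.2.1 hk' hk (src_coe (src k))
  · intro g hg h hh e
    exact (show source g = g from hg).symm.trans ((congrArg Subtype.val e).trans hh)
  · intro g hg h hh e
    have e1 := congrArg Subtype.val e
    change range g = range h at e1
    rwa [UnitSpace.range_eq ⟨g, hg⟩, UnitSpace.range_eq ⟨h, hh⟩] at e1

theorem IsOpenBisection.t2Space {B : Set G} (hB : IsOpenBisection B) : T2Space B :=
  T2Space.of_injective_continuous (f := fun b : B => src b.1)
    (fun _ _ e => Subtype.ext (hB.2.1 (Subtype.coe_prop _) (Subtype.coe_prop _) e))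
    (continuous_src.comp continuous_subtype_val)

open Classical in
/-- The section of the source map with values in `B`, extended by the identity. -/
def sourceSection (B : Set G) (z : UnitSpace G) : G :=
  if h : ∃ b ∈ B, src b = z then h.choose else z

theorem src_sourceSection (B : Set G) (z : UnitSpace G) : src (sourceSection B z) = z := by
  unfold sourceSection
  split_ifs with h
  · exact h.choose_spec.2
  · exact src_coe z

theorem IsOpenBisection.sourceSection_src {B : Set G} (hB : IsOpenBisection B) {b : G}
    (hb : b ∈ B) : sourceSection B (src b) = b := by
  have h : ∃ b' ∈ B, src b' = src b := ⟨b, hb, rfl⟩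
  unfold sourceSection
  rw [dif_pos h]
  exact hB.2.1 h.choose_spec.1 hb h.choose_spec.2

theorem sourceSection_mem {B : Set G} {z : UnitSpace G} (h : z ∈ src '' B) :
    sourceSection B z ∈ B := by
  obtain ⟨b, hb, e⟩ := h
  have h : ∃ b ∈ B, src b = z := ⟨b, hb, e⟩
  unfold sourceSection
  rw [dif_pos h]
  exact h.choose_spec.1

theorem sourceSection_mem_iff {B : Set G} {z : UnitSpace G} :
    sourceSection B z ∈ B ↔ z ∈ src '' B :=
  ⟨fun h => ⟨_, h, src_sourceSection B z⟩, sourceSection_mem⟩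

/-- The source map is open, so it carries neighbourhoods of `b` inside `B` to neighbourhoods of `src
b`, and the section undoes it on `B`. -/
theorem IsOpenBisection.continuousAt_sourceSection {B : Set G} (hB : IsOpenBisection B)
    {z : UnitSpace G} (hz : z ∈ src '' B) : ContinuousAt (sourceSection B) z := by
  obtain ⟨b, hb, rfl⟩ := hz
  rw [ContinuousAt, hB.sourceSection_src hb]
  intro W hW
  have h := isOpenMap_src.image_mem_nhds (inter_mem hW (hB.1.mem_nhds hb))
  refine mem_map.2 (mem_of_superset h ?_)
  rintro _ ⟨t, ⟨htW, htB⟩, rfl⟩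
  change sourceSection B (src t) ∈ W
  simpa only [hB.sourceSection_src htB] using htW

/-- Functions supported on a compact subset of an open bisection, on which they are continuous. -/
def IsBisectionFunction (B : Set G) (f : G → ℂ) : Prop :=
  ContinuousOn f B ∧ ∃ K ⊆ B, IsCompact K ∧ ∀ g ∉ K, f g = 0

theorem IsBisectionFunction.eq_zero {B : Set G} {f : G → ℂ} (hf : IsBisectionFunction B f) {g : G}
    (hg : g ∉ B) : f g = 0 := by
  obtain ⟨-, K, hK, -, h⟩ := hf
  exact h g fun hg' => hg (hK hg')

theorem IsBisectionFunction.mem_Cc {B : Set G} (hB : IsOpenBisection B) {f : G → ℂ}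
    (hf : IsBisectionFunction B f) : f ∈ Cc G := by
  have hf' := hf
  obtain ⟨hc, K, hKB, hK, h⟩ := hf
  have := hB.t2Space
  refine Submodule.subset_span ⟨B, hB.1, this, continuousOn_iff_continuous_domRestrict.1 hc, ?_,
    fun g hg => hf'.eq_zero hg⟩
  refine HasCompactSupport.intro (K := Subtype.val ⁻¹' K)
    ((Topology.IsInducing.subtypeVal.isCompact_preimage_iff (by simpa using hKB)).2 hK) ?_
  intro b hb
  exact h b.1 hb

/-- A partition of unity, taken inside the Hausdorff set `V` and subordinate to a finite cover of
the support by bisections, cuts a generator into functions living on single bisections. -/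
theorem mem_span_bisectionFunction {f : G → ℂ} (hf : f ∈ Cc G) :
    f ∈ Submodule.span ℂ {f : G → ℂ | ∃ B, IsOpenBisection B ∧ IsBisectionFunction B f} := by
  classical
  refine Submodule.span_le.2 ?_ hf
  rintro f ⟨V, hV, hT2, hcont, hsupp, hzero⟩
  have : LocallyCompactSpace G := IsLocallyCompactEtale.locallyCompactSpace
  have hVc : LocallyCompactSpace V := hV.locallyCompactSpace
  choose D hD hgD using exists_isOpenBisection (G := G)
  obtain ⟨t, ht⟩ := IsCompact.elim_finite_subcover (ι := V) hsupp
    (fun v => Subtype.val ⁻¹' (D v.1)) (fun v => (hD v.1).1.preimage continuous_subtype_val)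
    (fun v _ => Set.mem_iUnion.2 ⟨v, hgD v.1⟩)
  obtain ⟨n, e⟩ : ∃ n, Nonempty (t ≃ Fin n) := ⟨_, ⟨t.equivFin⟩⟩
  obtain ⟨e⟩ := e
  obtain ⟨p, hp1, hp2, hp3, hp4⟩ := exists_continuous_sum_one_of_isOpen_isCompact
    (s := fun i : Fin n => (Subtype.val ⁻¹' (D (e.symm i).1.1) : Set V))
    (t := tsupport (V.domRestrict f))
    (fun i => (hD _).1.preimage continuous_subtype_val) hsupp (by
      intro v hv
      obtain ⟨w, hw, hv⟩ := Set.mem_iUnion₂.1 (ht hv)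
      exact Set.mem_iUnion.2 ⟨e ⟨w, hw⟩, by simpa using hv⟩)
  let F : Fin n → G → ℂ := fun i g => if h : g ∈ V then f g * (p i ⟨g, h⟩ : ℂ) else 0
  have hsum : f = ∑ i, F i := by
    funext g
    rw [Finset.sum_apply]
    by_cases hg : g ∈ V
    · simp only [F, dif_pos hg]
      rw [← Finset.mul_sum]
      by_cases hf0 : f g = 0
      · simp [hf0]
      · have h1 := hp2 (x := ⟨g, hg⟩) (subset_tsupport _ hf0)
        simp only [Finset.sum_apply, Pi.one_apply] at h1
        rw [← Complex.ofReal_sum, h1]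
        simp
    · simp [F, hg, hzero g hg]
  rw [hsum]
  refine Submodule.sum_mem _ fun i _ => Submodule.subset_span ?_
  refine ⟨V ∩ D (e.symm i).1.1, (hD (e.symm i).1.1).mono (hV.inter (hD _).1) Set.inter_subset_right,
    ?_, Subtype.val '' (tsupport (V.domRestrict f) ∩ tsupport (p i)), ?_, ?_, ?_⟩
  · have : ContinuousOn (F i) V := by
      rw [continuousOn_iff_continuous_domRestrict]
      have : V.domRestrict (F i) = fun v => V.domRestrict f v * (p i v : ℂ) := by
        funext v
        exact dif_pos v.2
      rw [this]
      exact hcont.mul (Complex.continuous_ofReal.comp (p i).continuous)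
    exact this.mono Set.inter_subset_left
  · rintro _ ⟨v, hv, rfl⟩
    exact ⟨v.2, hp1 i hv.2⟩
  · exact ((IsCompact.inter_right hsupp (isClosed_tsupport _))).image continuous_subtype_val
  · intro g hg
    by_contra hne
    have hgV : g ∈ V := by
      by_contra h
      exact hne (dif_neg h)
    have h1 : F i g = f g * (p i ⟨g, hgV⟩ : ℂ) := dif_pos hgV
    rw [h1] at hne
    refine hg ⟨⟨g, hgV⟩, ⟨subset_tsupport _ (left_ne_zero_of_mul hne), subset_tsupport _ ?_⟩, rfl⟩
    intro h0
    exact right_ne_zero_of_mul hne (by rw [h0]; simp)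

/-- Transport of a function on the unit space to a bisection along the source map. -/
def bisectionLift (B : Set G) (φ : UnitSpace G → ℝ) (g : G) : ℂ :=
  open Classical in if g ∈ B then (φ (src g) : ℂ) else 0

theorem isBisectionFunction_bisectionLift {B : Set G} (hB : IsOpenBisection B)
    {φ : UnitSpace G → ℝ} (hφ : Continuous φ) (hc : HasCompactSupport φ)
    (hs : tsupport φ ⊆ src '' B) : IsBisectionFunction B (bisectionLift B φ) := by
  refine ⟨?_, sourceSection B '' tsupport φ, ?_, ?_, ?_⟩
  · refine ContinuousOn.congr (f := fun g => (φ (src g) : ℂ)) ?_ fun g hg => if_pos hg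
    exact (Complex.continuous_ofReal.comp (hφ.comp continuous_src)).continuousOn
  · rintro _ ⟨z, hz, rfl⟩
    exact sourceSection_mem (hs hz)
  · exact IsCompact.image_of_continuousOn hc fun z hz =>
      (hB.continuousAt_sourceSection (hs hz)).continuousWithinAt
  · intro g hg
    by_contra hne
    have hgB : g ∈ B := by
      by_contra h
      exact hne (if_neg h)
    have h1 : bisectionLift B φ g = φ (src g) := if_pos hgB
    rw [h1] at hne
    refine hg ⟨src g, subset_tsupport _ (by exact_mod_cast hne), hB.sourceSection_src hgB⟩

theorem exists_bump {x : UnitSpace G} {W : Set (UnitSpace G)} (hW : W ∈ 𝓝 x) :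
    ∃ φ : UnitSpace G → ℝ, Continuous φ ∧ HasCompactSupport φ ∧ tsupport φ ⊆ W ∧ φ x = 1 := by
  obtain ⟨K, hK, hxK, hKW⟩ := exists_compact_subset isOpen_interior (mem_interior_iff_mem_nhds.2 hW)
  obtain ⟨f, h1, h2, h3, -⟩ := exists_continuous_one_zero_of_isCompact (isCompact_singleton (x := x))
    (t := (interior K)ᶜ) isOpen_interior.isClosed_compl
    (Set.disjoint_singleton_left.2 fun h => h hxK)
  refine ⟨f, f.continuous, h3, ?_, h1 rfl⟩
  have h4 : tsupport f ⊆ K := closure_minimal (fun z hz => by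
    by_contra h
    exact hz (h2 fun h' => h (interior_subset h'))) hK.isClosed
  exact h4.trans (hKW.trans interior_subset)

end Bisections

/-! ### Cancellation and inverses of arrows -/

section Inverses
variable {G : Type u} [ArrowGroupoid G]

theorem eq_inv_of_mul_eq {a b : G} (h : src a = rng b) (hab : a * b = range a) : b = a⁻¹ := by
  have h1 : (a⁻¹ * a) * b = a⁻¹ * (a * b) := mul_assoc_of (src_inv a) h
  rw [inv_mul_self, hab, source_of_src h, ← source_inv a, mul_source] at h1
  exact (range_mul_self b).symm.trans h1

theorem arrow_inv_inv (g : G) : g⁻¹⁻¹ = g :=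
  (eq_inv_of_mul_eq (src_inv g) ((inv_mul_self g).trans (range_inv g).symm)).symm

theorem arrow_mul_inv_cancel_right {a b : G} (h : src a = rng b) : a * b * b⁻¹ = a := by
  rw [mul_assoc_of h (rng_inv b).symm, mul_inv_self, show range b = source a from (source_of_src h).symm]
  exact mul_source a

theorem arrow_inv_mul_cancel_right {a b : G} (h : src a = src b) : a * b⁻¹ * b = a := by
  have := arrow_mul_inv_cancel_right (a := a) (b := b⁻¹) (h.trans (rng_inv b).symm)
  rwa [arrow_inv_inv] at this

theorem arrow_mul_inv_rev {a b : G} (h : src a = rng b) : (a * b)⁻¹ = b⁻¹ * a⁻¹ := by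
  have h1 : src b⁻¹ = rng a⁻¹ := by rw [src_inv, rng_inv, h]
  have h2 : src (a * b) = rng b⁻¹ := by rw [src_mul h, rng_inv]
  refine (eq_inv_of_mul_eq ?_ ?_).symm
  · rw [src_mul h, rng_mul h1, rng_inv]
  · rw [← mul_assoc_of h2 h1, arrow_mul_inv_cancel_right h, mul_inv_self]
    exact (congrArg Subtype.val (rng_mul h)).symm

theorem mul_inv_inv {y : UnitSpace G} (g k : SourceFiber y) : (k.1 * g.1⁻¹)⁻¹ = g.1 * k.1⁻¹ := by
  rw [arrow_mul_inv_rev (src_div k g), arrow_inv_inv]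

end Inverses

/-! ### The standard basis of the fibre Hilbert spaces -/

section Delta
variable {G : Type u} [ArrowGroupoid G]

open Classical in
/-- The basis vector of `ℓ²(G_y)` at `k`. -/
def delta {y : UnitSpace G} (k : SourceFiber y) : HilbertFiber y :=
  lp.single 2 k (1 : ℂ)

open Classical in
theorem delta_apply {y : UnitSpace G} (k g : SourceFiber y) :
    delta k g = if g = k then 1 else 0 := by
  unfold delta
  rw [lp.single_apply]
  by_cases h : g = k
  · subst h
    simp
  · simp [h]

theorem norm_delta {y : UnitSpace G} (k : SourceFiber y) : ‖delta k‖ = 1 := by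
  classical
  unfold delta
  rw [lp.norm_single (by norm_num)]
  simp

theorem inner_delta_left {y : UnitSpace G} (k : SourceFiber y) (ξ : HilbertFiber y) :
    inner ℂ (delta k) ξ = ξ k := by
  classical
  unfold delta
  rw [lp.inner_single_left]
  simp

theorem norm_apply_le {y : UnitSpace G} (k : SourceFiber y) (ξ : HilbertFiber y) :
    ‖ξ k‖ ≤ ‖ξ‖ := by
  rw [← inner_delta_left]
  exact (norm_inner_le_norm _ _).trans (by rw [norm_delta, one_mul])

theorem operator_ext {y : UnitSpace G} {S T : HilbertFiber y →L[ℂ] HilbertFiber y}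
    (h : ∀ k g, S (delta k) g = T (delta k) g) : S = T := by
  classical
  ext ξ g
  have h1 : ∀ k, S (delta k) = T (delta k) := fun k => by
    ext g
    exact h k g
  have h2 := lp.hasSum_single (p := 2) (by norm_num) ξ
  have h3 : ∀ k, lp.single 2 k (ξ k) = ξ k • delta k := fun k => by
    unfold delta
    rw [← lp.single_smul]
    simp
  simp_rw [h3] at h2
  have hS := h2.mapL S
  have hT := h2.mapL T
  simp only [map_smul, h1] at hS hT
  rw [hS.unique hT]

/-- The unit `y` as an element of `G_y`. -/
def unitFiber (y : UnitSpace G) : SourceFiber y := ⟨y, src_coe y⟩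

end Delta

/-! ### Matrix coefficients and monomial operators -/

section Coefficients
variable {G : Type u} [TopologicalSpace G] [ArrowGroupoid G] [IsLocallyCompactEtale G]

theorem rhoCc_apply (y : UnitSpace G) (f : Cc G) (ξ : HilbertFiber y) (g : SourceFiber y) :
    rhoCc y f ξ g = ∑' k : SourceFiber y, (f : G → ℂ) (g.1 * k.1⁻¹) * ξ k :=
  rhoFun_eq y f ξ g

theorem rhoCc_delta (y : UnitSpace G) (f : Cc G) (k g : SourceFiber y) :
    rhoCc y f (delta k) g = (f : G → ℂ) (g.1 * k.1⁻¹) := by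
  rw [rhoCc_apply, tsum_eq_single k]
  · simp [delta_apply]
  · intro l hl
    simp [delta_apply, hl]

theorem operatorProduct_ext {a b : OperatorProduct G}
    (h : ∀ y (k g : SourceFiber y), a.1 y (delta k) g = b.1 y (delta k) g) : a = b :=
  Subtype.ext (funext fun y => operator_ext (h y))

theorem rhoFamily_add (f₁ f₂ : Cc G) : rhoFamily (f₁ + f₂) = rhoFamily f₁ + rhoFamily f₂ := by
  refine operatorProduct_ext fun y k g => ?_
  change rhoCc y (f₁ + f₂) (delta k) g = rhoCc y f₁ (delta k) g + rhoCc y f₂ (delta k) g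
  simp only [rhoCc_delta]
  rfl

theorem rhoFamily_smul (c : ℂ) (f : Cc G) : rhoFamily (c • f) = c • rhoFamily f := by
  refine operatorProduct_ext fun y k g => ?_
  change rhoCc y (c • f) (delta k) g = c * rhoCc y f (delta k) g
  simp only [rhoCc_delta]
  rfl

theorem rhoFamily_zero : rhoFamily (0 : Cc G) = 0 := by
  simpa using rhoFamily_smul (0 : ℂ) (0 : Cc G)

theorem star_rhoFamily {f₁ f₂ : Cc G} (h : ∀ g, (f₂ : G → ℂ) g = star ((f₁ : G → ℂ) g⁻¹)) :
    star (rhoFamily f₁) = rhoFamily f₂ := by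
  refine operatorProduct_ext fun y k g => ?_
  change (ContinuousLinearMap.adjoint (rhoCc y f₁)) (delta k) g = rhoCc y f₂ (delta k) g
  rw [← inner_delta_left, ContinuousLinearMap.adjoint_inner_right, ← inner_conj_symm,
    inner_delta_left, rhoCc_delta, rhoCc_delta, h, mul_inv_inv]
  rfl

theorem norm_proj_le (a : OperatorProduct G) (y : UnitSpace G) : ‖a.1 y‖ ≤ ‖a‖ :=
  lp.norm_apply_le_norm (by simp) a y

/-- The class in `C*_r(G)` of an element of `C_c(G)`. -/
def ofCc (f : Cc G) : ReducedCStarAlgebra G :=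
  ⟨rhoFamily f, NonUnitalStarSubalgebra.le_topologicalClosure _
    (NonUnitalStarAlgebra.subset_adjoin ℂ _ ⟨f, rfl⟩)⟩

theorem rho_ofCc (y : UnitSpace G) (f : Cc G) : rho y (ofCc f) = rhoCc y f := rfl

theorem rho_apply (y : UnitSpace G) (a : ReducedCStarAlgebra G) : rho y a = a.1.1 y := rfl

/-- `a` moves the basis vector at `k` to a multiple `c (r(k))` of the basis vector at
`h (r(k)) k`. -/
structure IsMonomial (a : OperatorProduct G) (c : UnitSpace G → ℂ) (h : UnitSpace G → G) :
    Prop where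
  src_eq (z : UnitSpace G) : src (h z) = z
  cont : Continuous c
  contAt (z : UnitSpace G) : c z ≠ 0 → ContinuousAt h z
  apply_delta (y : UnitSpace G) (k l : SourceFiber y) : l.1 = h (rng k.1) * k.1 →
    a.1 y (delta k) = c (rng k.1) • delta l

theorem IsMonomial.apply_unit {a : OperatorProduct G} {c : UnitSpace G → ℂ} {h : UnitSpace G → G}
    (H : IsMonomial a c h) {z : UnitSpace G} (l : SourceFiber z) (hl : l.1 = h z) :
    a.1 z (delta (unitFiber z)) = c z • delta l := by
  have h1 := H.apply_delta z (unitFiber z) l ?_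
  · rw [h1]
    change c (rng (z : G)) • _ = _
    rw [rng_coe]
  · change l.1 = h (rng (z : G)) * z
    have h2 := mul_source (h z)
    rw [source_of_src (H.src_eq z)] at h2
    rw [rng_coe, h2, hl]

/-- Bounds `c` uniformly; this keeps the coefficient of a product under control at points where the
inner translation is discontinuous. -/
theorem IsMonomial.norm_le {a : OperatorProduct G} {c : UnitSpace G → ℂ} {h : UnitSpace G → G}
    (H : IsMonomial a c h) (z : UnitSpace G) : ‖c z‖ ≤ ‖a‖ := by
  obtain ⟨l, hl⟩ : ∃ l : SourceFiber z, l.1 = h z := ⟨⟨h z, H.src_eq z⟩, rfl⟩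
  have h1 := (a.1 z).le_opNorm (delta (unitFiber z))
  rw [H.apply_unit l hl, norm_smul, norm_delta, norm_delta, mul_one, mul_one] at h1
  exact h1.trans (norm_proj_le a z)

/-- Multiplication is continuous only on composable pairs, hence the eventual composability
assumption. -/
theorem tendsto_mul {ι : Type*} {l : Filter ι} {a b : ι → G} {g h : G} (ha : Tendsto a l (𝓝 g))
    (hb : Tendsto b l (𝓝 h)) (hab : ∀ᶠ i in l, src (a i) = rng (b i)) (hgh : src g = rng h) :
    Tendsto (fun i => a i * b i) l (𝓝 (g * h)) := by
  have h1 := IsLocallyCompactEtale.continuousOn_mul (G := G) (g, h) hgh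
  exact h1.tendsto.comp (tendsto_nhdsWithin_iff.2 ⟨ha.prodMk_nhds hb, hab⟩)

theorem IsMonomial.mul {a b : OperatorProduct G} {c d : UnitSpace G → ℂ} {h k : UnitSpace G → G}
    (H : IsMonomial a c h) (K : IsMonomial b d k) :
    IsMonomial (a * b) (fun z => d z * c (rng (k z))) (fun z => h (rng (k z)) * k z) := by
  have hcomp : ∀ z, src (h (rng (k z))) = rng (k z) := fun z => H.src_eq _
  refine ⟨fun z => by rw [src_mul (hcomp z), K.src_eq], continuous_iff_continuousAt.2 fun z => ?_,
    fun z hz => ?_, fun y m l hl => ?_⟩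
  -- Where `d` vanishes, `k` may be discontinuous, so continuity comes from the bound `‖d‖ * ‖a‖`
  -- instead of from composition.
  · by_cases hz : d z = 0
    · rw [ContinuousAt, hz, zero_mul]
      refine squeeze_zero_norm (a := fun z => ‖d z‖ * ‖a‖) (fun t => ?_) ?_
      · rw [norm_mul]
        gcongr
        exact H.norm_le _
      · have := (K.cont.norm.mul_const ‖a‖).tendsto z
        rwa [hz, norm_zero, zero_mul] at this
    · exact K.cont.continuousAt.mul
        (H.cont.continuousAt.comp (continuous_rng.continuousAt.comp (K.contAt z hz)))
  · have hd := left_ne_zero_of_mul hz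
    have hc := right_ne_zero_of_mul hz
    have hk := K.contAt z hd
    exact tendsto_mul ((H.contAt _ hc).tendsto.comp (continuous_rng.continuousAt.tendsto.comp hk))
      hk (Eventually.of_forall hcomp) (hcomp z)
  · have hkm : src (k (rng m.1)) = rng m.1 := K.src_eq _
    let l' : SourceFiber y := ⟨k (rng m.1) * m.1, by rw [src_mul hkm, m.2]⟩
    have hr : rng l'.1 = rng (k (rng m.1)) := rng_mul hkm
    change a.1 y (b.1 y (delta m)) = _
    rw [K.apply_delta y m l' rfl, map_smul, H.apply_delta y l' l ?_, smul_smul, hr]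
    rw [hl, hr]
    exact mul_assoc_of (hcomp _) hkm

/-- The matrix entry at `(g, k)` is `f (g * k⁻¹)`, and at most one arrow of `B` has source `rng k`;
so each column has at most one nonzero entry. -/
theorem isMonomial_rhoFamily {B : Set G} (hB : IsOpenBisection B) {f : Cc G}
    (hf : IsBisectionFunction B (f : G → ℂ)) :
    IsMonomial (rhoFamily f) (fun z => (f : G → ℂ) (sourceSection B z)) (sourceSection B) := by
  have hcont : ∀ z, z ∈ src '' B → ContinuousAt (sourceSection B) z :=
    fun z hz => hB.continuousAt_sourceSection hz
  refine ⟨src_sourceSection B, continuous_iff_continuousAt.2 fun z => ?_, fun z hz => ?_,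
    fun y k l hl => ?_⟩
  · by_cases hz : z ∈ src '' B
    · have h1 : ContinuousAt (f : G → ℂ) (sourceSection B z) :=
        hf.1.continuousAt (hB.1.mem_nhds (sourceSection_mem hz))
      exact h1.comp (hcont z hz)
    -- Although `f` itself may be discontinuous on a non-Hausdorff `G`, its coefficient on the unit
    -- space is continuous: `src '' K` is compact, hence closed there, and the coefficient vanishes
    -- on the complement.
    · obtain ⟨-, K, hKB, hK, h⟩ := hf
      have hcl : IsClosed (src '' K : Set (UnitSpace G)) := (hK.image continuous_src).isClosed
      have h2 : ∀ t ∉ (src '' K : Set (UnitSpace G)), (f : G → ℂ) (sourceSection B t) = 0 :=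
        fun t ht => h _ fun hm => ht ⟨_, hm, src_sourceSection B t⟩
      have hzK : z ∉ (src '' K : Set (UnitSpace G)) := fun hm => hz (Set.image_mono hKB hm)
      rw [ContinuousAt, h2 z hzK]
      refine Tendsto.congr' ?_ tendsto_const_nhds
      filter_upwards [hcl.isOpen_compl.mem_nhds hzK] with t ht
      exact (h2 t ht).symm
  · refine hcont z (sourceSection_mem_iff.1 ?_)
    by_contra h
    exact hz (hf.eq_zero h)
  · ext g
    change rhoCc y f (delta k) g = (f : G → ℂ) (sourceSection B (rng k.1)) * delta l g
    rw [rhoCc_delta, delta_apply]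
    split_ifs with hgl
    · rw [hgl, hl, arrow_mul_inv_cancel_right (src_sourceSection B _), mul_one]
    · rw [mul_zero]
      by_contra hne
      have hmem : g.1 * k.1⁻¹ ∈ B := by
        by_contra h
        exact hne (hf.eq_zero h)
      have h1 : src (g.1 * k.1⁻¹) = rng k.1 := by rw [src_mul (src_div g k), src_inv]
      refine hgl (Subtype.ext ?_)
      rw [hl, ← h1, hB.sourceSection_src hmem, arrow_inv_mul_cancel_right (g.2.trans k.2.symm)]

theorem IsOpenBisection.inv {B : Set G} (hB : IsOpenBisection B) :
    IsOpenBisection ((fun g : G => g⁻¹) ⁻¹' B) := by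
  refine ⟨hB.1.preimage IsLocallyCompactEtale.continuous_inv, fun g hg h hh e => ?_,
    fun g hg h hh e => ?_⟩
  · rw [← arrow_inv_inv g, ← arrow_inv_inv h]
    exact congrArg _ (hB.2.2 hg hh (by rwa [rng_inv, rng_inv]))
  · rw [← arrow_inv_inv g, ← arrow_inv_inv h]
    exact congrArg _ (hB.2.1 hg hh (by rwa [src_inv, src_inv]))

theorem IsBisectionFunction.star {B : Set G} {f : G → ℂ} (hf : IsBisectionFunction B f) :
    IsBisectionFunction ((fun g : G => g⁻¹) ⁻¹' B) (fun g => star (f g⁻¹)) := by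
  obtain ⟨hc, K, hKB, hK, h⟩ := hf
  have hinv : Continuous fun g : G => g⁻¹ := IsLocallyCompactEtale.continuous_inv
  refine ⟨continuous_star.comp_continuousOn (hc.comp hinv.continuousOn fun g hg => hg),
    (fun g : G => g⁻¹) '' K, ?_, hK.image hinv, fun g hg => ?_⟩
  · rintro _ ⟨g, hg, rfl⟩
    change g⁻¹⁻¹ ∈ B
    rw [arrow_inv_inv]
    exact hKB hg
  · change Star.star (f g⁻¹) = 0
    rw [h, star_zero]
    exact fun h' => hg ⟨_, h', arrow_inv_inv g⟩

variable (G) in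
/-- The linear span of the monomial families. -/
def monomialSpan : Submodule ℂ (OperatorProduct G) :=
  Submodule.span ℂ {a | ∃ c h, IsMonomial a c h}

theorem rhoFamily_mem_monomialSpan (f : Cc G) :
    rhoFamily f ∈ monomialSpan G ∧ star (rhoFamily f) ∈ monomialSpan G := by
  have key : ∀ f' ∈ Submodule.span ℂ {f : G → ℂ | ∃ B, IsOpenBisection B ∧ IsBisectionFunction B f},
      ∃ hf : f' ∈ Cc G, rhoFamily ⟨f', hf⟩ ∈ monomialSpan G ∧
        star (rhoFamily ⟨f', hf⟩) ∈ monomialSpan G := by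
    intro f' hf'
    induction hf' using Submodule.span_induction with
    | mem f hf =>
      obtain ⟨B, hB, hf⟩ := hf
      refine ⟨hf.mem_Cc hB, Submodule.subset_span ⟨_, _, isMonomial_rhoFamily hB hf⟩, ?_⟩
      rw [star_rhoFamily (f₂ := ⟨_, hf.star.mem_Cc hB.inv⟩) fun g => rfl]
      exact Submodule.subset_span ⟨_, _, isMonomial_rhoFamily hB.inv hf.star⟩
    | zero =>
      refine ⟨Submodule.zero_mem _, ?_⟩
      change rhoFamily (0 : Cc G) ∈ _ ∧ star (rhoFamily (0 : Cc G)) ∈ _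
      rw [rhoFamily_zero, star_zero]
      exact ⟨Submodule.zero_mem _, Submodule.zero_mem _⟩
    | add f₁ f₂ _ _ h₁ h₂ =>
      obtain ⟨m₁, h₁, h₁'⟩ := h₁
      obtain ⟨m₂, h₂, h₂'⟩ := h₂
      refine ⟨Submodule.add_mem _ m₁ m₂, ?_⟩
      change rhoFamily ((⟨f₁, m₁⟩ : Cc G) + ⟨f₂, m₂⟩) ∈ _ ∧
        star (rhoFamily ((⟨f₁, m₁⟩ : Cc G) + ⟨f₂, m₂⟩)) ∈ _
      rw [rhoFamily_add, star_add]
      exact ⟨Submodule.add_mem _ h₁ h₂, Submodule.add_mem _ h₁' h₂'⟩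
    | smul c f _ h =>
      obtain ⟨m, h, h'⟩ := h
      refine ⟨Submodule.smul_mem _ c m, ?_⟩
      change rhoFamily (c • (⟨f, m⟩ : Cc G)) ∈ _ ∧ star (rhoFamily (c • (⟨f, m⟩ : Cc G))) ∈ _
      rw [rhoFamily_smul, star_smul]
      exact ⟨Submodule.smul_mem _ _ h, Submodule.smul_mem _ _ h'⟩
  exact (key f (mem_span_bisectionFunction f.2)).2

theorem mul_mem_monomialSpan {a b : OperatorProduct G} (ha : a ∈ monomialSpan G)
    (hb : b ∈ monomialSpan G) : a * b ∈ monomialSpan G := by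
  unfold monomialSpan at ha hb
  induction ha, hb using Submodule.span_induction₂ with
  | mem_mem a b ha hb =>
    obtain ⟨c, h, ha⟩ := ha
    obtain ⟨d, k, hb⟩ := hb
    exact Submodule.subset_span ⟨_, _, ha.mul hb⟩
  | zero_left b _ =>
    rw [zero_mul]
    exact Submodule.zero_mem _
  | zero_right a _ =>
    rw [mul_zero]
    exact Submodule.zero_mem _
  | add_left a b c _ _ _ h₁ h₂ =>
    rw [add_mul]
    exact Submodule.add_mem _ h₁ h₂
  | add_right a b c _ _ _ h₁ h₂ =>
    rw [mul_add]
    exact Submodule.add_mem _ h₁ h₂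
  | smul_left r a b _ _ h =>
    rw [smul_mul_assoc]
    exact Submodule.smul_mem _ _ h
  | smul_right r a b _ _ h =>
    rw [mul_smul_comm]
    exact Submodule.smul_mem _ _ h

/-- The monomial span contains the generators and their adjoints and is closed under products, so it
contains the star algebra whose closure is the reduced algebra. -/
theorem mem_closure_monomialSpan (a : ReducedCStarAlgebra G) :
    a.1 ∈ closure (monomialSpan G : Set (OperatorProduct G)) := by
  refine closure_mono ?_ a.2
  intro b hb
  have hb' : b ∈ NonUnitalAlgebra.adjoin ℂ
      (Set.range (rhoFamily (G := G)) ∪ star (Set.range (rhoFamily (G := G)))) := hb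
  clear hb
  induction hb' using NonUnitalAlgebra.adjoin_induction with
  | mem b hb =>
    rcases hb with ⟨f, rfl⟩ | ⟨f, hf⟩
    · exact (rhoFamily_mem_monomialSpan f).1
    · rw [← star_star b, ← hf]
      exact (rhoFamily_mem_monomialSpan f).2
  | zero => exact Submodule.zero_mem _
  | add a b _ _ ha hb => exact Submodule.add_mem _ ha hb
  | mul a b _ _ ha hb => exact mul_mem_monomialSpan ha hb
  | smul c a _ ha => exact Submodule.smul_mem _ c ha

end Coefficients

/-! ### Filters approaching `x`, convergence of states, and nets -/

section Approach
variable {G : Type u} [TopologicalSpace G] [ArrowGroupoid G]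

/-- A filter on the unit space approaching `x` through `Y`, with no accumulation point in the
isotropy group of `x` other than `x`. -/
structure ApproachFilter (Y : Set (UnitSpace G)) (x : UnitSpace G) (l : Filter (UnitSpace G)) :
    Prop where
  neBot : l.NeBot
  le_nhds : l ≤ 𝓝 x
  mem : Y ∈ l
  avoid (g : Isotropy x) : g ≠ 1 → ∃ B, IsOpenBisection B ∧ (g : G) ∈ B ∧
    ∀ᶠ y : UnitSpace G in l, (y : G) ∉ B

variable [IsLocallyCompactEtale G]

/-- The sets satisfying `P` form an ideal, and `l` is its dual filter. Properness of `l` is exactly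
the failure of (*), and avoidance holds because the units in a single bisection around `g ≠ 1`
already satisfy `P`. -/
theorem exists_approachFilter {Y : Set (UnitSpace G)} {x : UnitSpace G} (hx : x ∈ closure Y)
    (h : ¬ CoveredNear Y x) : ∃ l, ApproachFilter Y x l := by
  let P : Set (UnitSpace G) → Prop := fun s => ∃ T : Finset (Set G),
    (∀ B ∈ T, IsOpenBisection B ∧ ∃ g : Isotropy x, g ≠ 1 ∧ (g : G) ∈ B) ∧
      ∀ᶠ y in 𝓝[Y] x, y ∈ s → ∃ B ∈ T, (y : G) ∈ B
  -- With no bisections at all, `P` holds for sets that miss `Y` near `x`; this gives both `l ≤ 𝓝 x`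
  -- and `Y ∈ l`.
  have h0 : ∀ s, (∀ᶠ y in 𝓝[Y] x, y ∉ s) → P s := fun s hs =>
    ⟨∅, by simp, hs.mono fun y hy hy' => absurd hy' hy⟩
  let l : Filter (UnitSpace G) := Filter.comk P (h0 _ (by simp))
    (fun t ⟨T, hT, ht⟩ s hst => ⟨T, hT, ht.mono fun y hy hys => hy (hst hys)⟩)
    (by
      classical
      rintro s ⟨T, hT, hs⟩ t ⟨T', hT', ht⟩
      refine ⟨T ∪ T', fun B hB => ?_, ?_⟩
      · rcases Finset.mem_union.1 hB with hB | hB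
        · exact hT B hB
        · exact hT' B hB
      · filter_upwards [hs, ht] with y h1 h2 hy
        rcases hy with hy | hy
        · obtain ⟨B, hB, hyB⟩ := h1 hy
          exact ⟨B, Finset.mem_union_left _ hB, hyB⟩
        · obtain ⟨B, hB, hyB⟩ := h2 hy
          exact ⟨B, Finset.mem_union_right _ hB, hyB⟩)
  have hmem : ∀ s, s ∈ l ↔ P sᶜ := fun s => by rw [← compl_compl s, compl_mem_comk, compl_compl]
  refine ⟨l, ⟨?_⟩, ?_, ?_, ?_⟩
  · intro hbot
    have h1 : ∅ ∈ l := by rw [hbot]; trivial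
    rw [hmem] at h1
    obtain ⟨T, hT, hev⟩ := h1
    have hne : (𝓝[Y] x).NeBot := mem_closure_iff_nhdsWithin_neBot.1 hx
    simp only [Set.compl_empty, Set.mem_univ, true_imp_iff] at hev
    -- As `x` is in the closure of `Y`, some point of `Y` is covered, so `T` is nonempty; this
    -- supplies `1 ≤ n`.
    obtain ⟨y, B, hB, -⟩ := hev.exists
    choose! g hg using fun B hB => (hT B hB).2
    rw [eventually_nhdsWithin_iff] at hev
    refine h ⟨T.card, Finset.card_pos.2 ⟨B, hB⟩, fun k => g (T.equivFin.symm k).1,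
      fun k => (T.equivFin.symm k).1, {y | y ∈ Y → ∃ B ∈ T, (y : G) ∈ B},
      fun k => ⟨(hg _ (T.equivFin.symm k).2).1, (hT _ (T.equivFin.symm k).2).1,
        (hg _ (T.equivFin.symm k).2).2⟩, hev, fun y hy => ?_⟩
    obtain ⟨B, hB, hyB⟩ := hy.2 hy.1
    exact Set.mem_iUnion.2 ⟨T.equivFin ⟨B, hB⟩, by simpa using hyB⟩
  · intro s hs
    rw [hmem]
    exact h0 _ (by filter_upwards [mem_nhdsWithin_of_mem_nhds hs] with y hy hy' using hy' hy)
  · rw [hmem]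
    exact h0 _ (by filter_upwards [self_mem_nhdsWithin] with y hy hy' using hy' hy)
  · intro g hg
    obtain ⟨B, hB, hgB⟩ := exists_isOpenBisection (g : G)
    refine ⟨B, hB, hgB, (hmem _).2 ⟨{B}, ?_, ?_⟩⟩
    · intro B' hB'
      rw [Finset.mem_singleton.1 hB']
      exact ⟨hB, g, hg, hgB⟩
    · refine Eventually.of_forall fun y hy => ⟨B, Finset.mem_singleton_self _, ?_⟩
      by_contra h
      exact hy h

/-- The diagonal coefficient of `a` at the unit `y`. -/
def unitCoeff (a : OperatorProduct G) (y : UnitSpace G) : ℂ :=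
  a.1 y (delta (unitFiber y)) (unitFiber y)

theorem norm_unitCoeff_le (a : OperatorProduct G) (y : UnitSpace G) : ‖unitCoeff a y‖ ≤ ‖a‖ := by
  refine (norm_apply_le _ _).trans (((a.1 y).le_opNorm _).trans ?_)
  rw [norm_delta, mul_one]
  exact norm_proj_le a y

theorem IsMonomial.unitCoeff_eq_zero {a : OperatorProduct G} {c : UnitSpace G → ℂ}
    {h : UnitSpace G → G} (H : IsMonomial a c h) {y : UnitSpace G} (hy : h y ≠ y) :
    unitCoeff a y = 0 := by
  obtain ⟨l, hl⟩ : ∃ l : SourceFiber y, l.1 = h y := ⟨⟨h y, H.src_eq y⟩, rfl⟩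
  unfold unitCoeff
  rw [H.apply_unit l hl]
  change c y * delta l (unitFiber y) = 0
  rw [delta_apply, if_neg, mul_zero]
  rintro rfl
  exact hy hl.symm

theorem IsMonomial.unitCoeff_eq {a : OperatorProduct G} {c : UnitSpace G → ℂ}
    {h : UnitSpace G → G} (H : IsMonomial a c h) {y : UnitSpace G} (hy : h y = y) :
    unitCoeff a y = c y := by
  unfold unitCoeff
  rw [H.apply_unit (unitFiber y) hy.symm]
  change c y * delta (unitFiber y) (unitFiber y) = c y
  rw [delta_apply, if_pos rfl, mul_one]

variable {Y : Set (UnitSpace G)} {x : UnitSpace G} {l : Filter (UnitSpace G)}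

/-- The coefficient is `c y` if `h y = y` and zero otherwise, so only the case `c x ≠ 0` is
delicate. If `h x = x`, a bisection around `x` forces `h y = y` nearby. If `h x` is a nontrivial
isotropy element, `l` avoids a bisection around it; otherwise the ranges of `h y` and `y` separate
in the Hausdorff unit space. -/
theorem ApproachFilter.tendsto_monomial (hl : ApproachFilter Y x l) {a : OperatorProduct G}
    {c : UnitSpace G → ℂ} {h : UnitSpace G → G} (H : IsMonomial a c h) :
    Tendsto (unitCoeff a) l (𝓝 (unitCoeff a x)) := by
  have hc : Tendsto c l (𝓝 (c x)) := (H.cont.tendsto x).mono_left hl.le_nhds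
  have hle : ∀ y, ‖unitCoeff a y‖ ≤ ‖c y‖ := fun y => by
    by_cases hy : h y = y
    · rw [H.unitCoeff_eq hy]
    · rw [H.unitCoeff_eq_zero hy, norm_zero]
      exact norm_nonneg _
  by_cases hcx : c x = 0
  · have h0 : unitCoeff a x = 0 := by simpa [hcx] using hle x
    rw [h0]
    refine squeeze_zero_norm hle ?_
    simpa [hcx] using hc.norm
  have hh : Tendsto h l (𝓝 (h x)) := (H.contAt x hcx).tendsto.mono_left hl.le_nhds
  have hcoe : Tendsto (fun y : UnitSpace G => (y : G)) l (𝓝 (x : G)) :=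
    (continuous_unitSpace_coe.tendsto x).mono_left hl.le_nhds
  by_cases hx : h x = x
  · rw [H.unitCoeff_eq hx]
    refine hc.congr' ?_
    obtain ⟨B, hB, hxB⟩ := exists_isOpenBisection (x : G)
    rw [hx] at hh
    filter_upwards [hh (hB.1.mem_nhds hxB), hcoe (hB.1.mem_nhds hxB)] with y h1 h2
    exact (H.unitCoeff_eq (hB.2.1 h1 h2 ((H.src_eq y).trans (src_coe y).symm))).symm
  · rw [H.unitCoeff_eq_zero hx]
    refine tendsto_const_nhds.congr' ?_
    suffices ∀ᶠ y in l, h y ≠ y from this.mono fun y hy => (H.unitCoeff_eq_zero hy).symm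
    by_cases hr : rng (h x) = x
    · obtain ⟨B, hB, hgB, hav⟩ := hl.avoid ⟨h x, H.src_eq x, hr⟩ fun e => hx (congrArg Subtype.val e)
      filter_upwards [hav, hh (hB.1.mem_nhds hgB)] with y h1 h2 e
      exact h1 (e ▸ h2)
    · have h1 : Tendsto (fun y => rng (h y)) l (𝓝 (rng (h x))) :=
        (continuous_rng.tendsto _).comp hh
      obtain ⟨U, V, hU, hV, hxU, hxV, hUV⟩ := t2_separation hr
      filter_upwards [h1 (hU.mem_nhds hxU), hl.le_nhds (hV.mem_nhds hxV)] with y h2 h3 e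
      refine Set.disjoint_left.1 hUV h2 ?_
      change rng (h y) ∈ V
      rwa [e, rng_coe]

/-- An `ε/3` argument: the coefficient is bounded by the norm uniformly in `y`. -/
theorem ApproachFilter.tendsto_unitCoeff (hl : ApproachFilter Y x l) (a : ReducedCStarAlgebra G) :
    Tendsto (unitCoeff a.1) l (𝓝 (unitCoeff a.1 x)) := by
  have hspan : ∀ b ∈ monomialSpan G, Tendsto (unitCoeff b) l (𝓝 (unitCoeff b x)) := by
    intro b hb
    unfold monomialSpan at hb
    induction hb using Submodule.span_induction with
    | mem b hb =>
      obtain ⟨c, h, H⟩ := hb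
      exact hl.tendsto_monomial H
    | zero => exact tendsto_const_nhds
    | add a b _ _ ha hb => exact ha.add hb
    | smul c a _ ha => exact ha.const_mul c
  rw [Metric.tendsto_nhds]
  intro ε hε
  obtain ⟨b, hb, hab⟩ := Metric.mem_closure_iff.1 (mem_closure_monomialSpan a) (ε / 3) (by positivity)
  have hdist : ∀ y, dist (unitCoeff a.1 y) (unitCoeff b y) < ε / 3 := fun y => by
    rw [dist_eq_norm] at hab ⊢
    exact (norm_unitCoeff_le (a.1 - b) y).trans_lt hab
  filter_upwards [Metric.tendsto_nhds.1 (hspan b hb) (ε / 3) (by positivity)] with y hy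
  have h1 := dist_triangle4 (unitCoeff a.1 y) (unitCoeff b y) (unitCoeff b x) (unitCoeff a.1 x)
  have h2 := hdist x
  rw [dist_comm] at h2
  linarith [hdist y]

theorem directSum_eq_zero_iff {A : Type u} [NonUnitalCStarAlgebra A] {ι : Type v} {H : ι → Type u}
    [∀ i, NormedAddCommGroup (H i)] [∀ i, InnerProductSpace ℂ (H i)] [∀ i, CompleteSpace (H i)]
    (π : ∀ i, A →⋆ₙₐ[ℂ] (H i →L[ℂ] H i)) (a : A) : directSum π a = 0 ↔ ∀ i, π i a = 0 := by
  classical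
  refine ⟨fun h i => ?_, fun h => ?_⟩
  · ext ξ
    have h1 : (directSum π a (lp.single 2 i ξ)) i = 0 := by
      rw [h]
      rfl
    have h2 : (directSum π a (lp.single 2 i ξ)) i = π i a ((lp.single 2 i ξ : lp H 2) i) := rfl
    rw [h2, lp.single_apply_self] at h1
    exact h1
  · ext ξ i
    change π i a (ξ i) = 0
    rw [h]
    rfl

theorem rhoCc_bisectionLift_delta_unit {B : Set G} (hB : IsOpenBisection B) {φ : UnitSpace G → ℝ}
    {f : Cc G} (hf : (f : G → ℂ) = bisectionLift B φ) (h1 : φ x = 1) {k : SourceFiber x}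
    (hkB : k.1 ∈ B) : rhoCc x f (delta (unitFiber x)) = delta k := by
  ext g
  rw [rhoCc_delta, delta_apply, hf]
  have h2 : g.1 * (unitFiber x).1⁻¹ = g.1 := by
    change g.1 * (x : G)⁻¹ = g.1
    have h3 := mul_source g.1
    rw [source_of_src g.2] at h3
    rw [UnitSpace.inv_coe, h3]
  rw [h2]
  unfold bisectionLift
  by_cases hgk : g = k
  · rw [if_pos hgk, hgk, if_pos hkB, k.2, h1]
    simp
  · rw [if_neg hgk, if_neg]
    intro hg
    exact hgk (Subtype.ext (hB.2.1 hg hkB (g.2.trans k.2.symm)))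

theorem exists_rhoCc_delta_unit (k : SourceFiber x) :
    ∃ f : Cc G, rhoCc x f (delta (unitFiber x)) = delta k := by
  obtain ⟨B, hB, hkB⟩ := exists_isOpenBisection k.1
  have hx : x ∈ src '' B := ⟨k.1, hkB, k.2⟩
  obtain ⟨φ, hφ, hc, hs, h1⟩ := exists_bump ((isOpenMap_src B hB.1).mem_nhds hx)
  exact ⟨⟨_, (isBisectionFunction_bisectionLift hB hφ hc hs).mem_Cc hB⟩,
    rhoCc_bisectionLift_delta_unit hB rfl h1 hkB⟩

/-- The unit coefficient of `star b * a * c` vanishes on `Y`, hence at `x` by passing to the limit.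
Choosing `b` and `c` that move `δ_x` to arbitrary basis vectors gives every matrix entry of
`ρ_x(a)`. -/
theorem ApproachFilter.weaklyContained (hl : ApproachFilter Y x l) :
    WeaklyContained (rho x) (directSum fun y : Y => rho (y : UnitSpace G)) := by
  intro a ha
  rw [directSum_eq_zero_iff] at ha
  have key : ∀ b c : ReducedCStarAlgebra G, unitCoeff (star b * a * c).1 x = 0 := by
    intro b c
    have := hl.neBot
    refine tendsto_nhds_unique (hl.tendsto_unitCoeff (star b * a * c)) ?_
    refine tendsto_const_nhds.congr' ?_
    filter_upwards [hl.mem] with y hy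
    have h1 : rho y (star b * a * c) = 0 := by
      rw [map_mul, map_mul, ha ⟨y, hy⟩, mul_zero, zero_mul]
    unfold unitCoeff
    rw [← rho_apply, h1]
    rfl
  refine operator_ext fun k g => ?_
  obtain ⟨f, hf⟩ := exists_rhoCc_delta_unit k
  obtain ⟨f', hf'⟩ := exists_rhoCc_delta_unit g
  have h1 := key (ofCc f') (ofCc f)
  unfold unitCoeff at h1
  rw [← rho_apply, map_mul, map_mul, map_star] at h1
  change (star (rho x (ofCc f')) (rho x a (rho x (ofCc f) (delta (unitFiber x))))) (unitFiber x)
    = 0 at h1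
  rw [rho_ofCc, rho_ofCc, hf, ← inner_delta_left, ContinuousLinearMap.star_eq_adjoint,
    ContinuousLinearMap.adjoint_inner_right, hf', inner_delta_left] at h1
  exact h1

theorem ApproachFilter.existsNetUniqueAcc (hl : ApproachFilter Y x l) : ExistsNetUniqueAcc Y x := by
  have := hl.neBot
  -- Indices are pairs of a set of `l` and a point of it in `Y`, ordered by reverse inclusion of the
  -- sets alone.
  let ι : Type u := {p : Set (UnitSpace G) × UnitSpace G // p.1 ∈ l ∧ p.2 ∈ p.1 ∩ Y}
  let _ : Preorder ι := Preorder.lift (β := (Set (UnitSpace G))ᵒᵈ) fun p => OrderDual.toDual p.1.1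
  have hle : ∀ p q : ι, p ≤ q ↔ q.1.1 ⊆ p.1.1 := fun p q => Iff.rfl
  have hex : ∀ s ∈ l, ∃ p : ι, p.1.1 = s := fun s hs => by
    obtain ⟨y, hy⟩ := (inter_mem hs hl.mem : s ∩ Y ∈ l) |> Filter.nonempty_of_mem
    exact ⟨⟨(s, y), hs, hy⟩, rfl⟩
  have hdir : IsDirectedOrder ι := ⟨fun p q => by
    obtain ⟨r, hr⟩ := hex _ (inter_mem p.2.1 q.2.1)
    refine ⟨r, (hle _ _).2 ?_, (hle _ _).2 ?_⟩
    · rw [hr]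
      exact Set.inter_subset_left
    · rw [hr]
      exact Set.inter_subset_right⟩
  have hne : Nonempty ι := ⟨(hex _ univ_mem).choose⟩
  have htend : Tendsto (fun p : ι => p.1.2) atTop l := fun s hs => by
    obtain ⟨p, hp⟩ := hex s hs
    refine mem_map.2 ?_
    filter_upwards [eventually_ge_atTop p] with q hq
    exact hp ▸ (hle _ _).1 hq q.2.2.1
  refine ⟨ι, inferInstance, hdir, hne, fun p => p.1.2, fun p => p.2.2.2, fun g => ⟨fun hg => ?_, ?_⟩⟩
  · by_contra hne
    obtain ⟨B, hB, hgB, hav⟩ := hl.avoid g hne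
    obtain ⟨p, h1, h2⟩ := ((mapClusterPt_iff_frequently.1 hg B (hB.1.mem_nhds hgB)).and_eventually
      (htend.eventually hav)).exists
    exact h2 h1
  · rintro rfl
    exact ((continuous_unitSpace_coe.tendsto x).comp (htend.mono_right hl.le_nhds)).mapClusterPt

/-- A unit `y` in `B` is the only arrow of `B` with source `y`, and that arrow tends to `g` as `y →
x`. -/
theorem tendsto_coe_of_mem_bisection {B : Set G} (hB : IsOpenBisection B) {g : Isotropy x}
    (hg : (g : G) ∈ B) :
    Tendsto (fun y : UnitSpace G => (y : G)) (𝓝 x ⊓ 𝓟 {y | (y : G) ∈ B}) (𝓝 (g : G)) := by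
  intro W hW
  have h1 := isOpenMap_src.image_mem_nhds (inter_mem hW (hB.1.mem_nhds hg))
  rw [g.2.1] at h1
  refine mem_map.2 (mem_of_superset (inter_mem (mem_inf_of_left h1)
    (mem_inf_of_right (mem_principal_self _))) ?_)
  rintro _ ⟨⟨b, ⟨hbW, hbB⟩, rfl⟩, hy⟩
  change ((src b : UnitSpace G) : G) ∈ W
  rwa [hB.2.1 hy hbB (src_coe (src b))]

/-- Since `y * y = y` and `y⁻¹ = y`, the isotropy elements that are limits of the units along `F`
form a subgroup. -/
theorem tendsto_coe_of_mem_zpowers {F : Filter (UnitSpace G)} (hF : F ≤ 𝓝 x) {g h : Isotropy x}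
    (hg : Tendsto (fun y : UnitSpace G => (y : G)) F (𝓝 (g : G)))
    (hh : h ∈ Subgroup.zpowers g) : Tendsto (fun y : UnitSpace G => (y : G)) F (𝓝 (h : G)) := by
  let S : Subgroup (Isotropy x) :=
    { carrier := {h | Tendsto (fun y : UnitSpace G => (y : G)) F (𝓝 (h : G))}
      one_mem' := (continuous_unitSpace_coe.tendsto x).mono_left hF
      mul_mem' := fun {a b} ha hb => by
        have h1 := tendsto_mul ha hb (Eventually.of_forall fun y => (src_coe y).trans (rng_coe y).symm)
          (a.2.1.trans b.2.2.symm)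
        simp only [UnitSpace.mul_self] at h1
        exact h1
      inv_mem' := fun {a} ha => by
        have h1 := ((IsLocallyCompactEtale.continuous_inv (G := G)).tendsto (a : G)).comp ha
        have h2 : (fun g : G => g⁻¹) ∘ (fun y : UnitSpace G => (y : G)) = fun y : UnitSpace G => (y : G) :=
          funext fun y => UnitSpace.inv_coe y
        rw [h2] at h1
        exact h1 }
  exact (Subgroup.zpowers_le.2 (show g ∈ S from hg)) hh

theorem not_coveredNear_of_existsNetUniqueAcc (h : ExistsNetUniqueAcc Y x) : ¬ CoveredNear Y x := by
  rintro ⟨n, -, g, B, U, hB, hU, hcov⟩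
  obtain ⟨ι, _, _, _, y, hyY, hy⟩ := h
  have h1 : MapClusterPt (x : G) atTop (fun i => (y i : G)) := (hy 1).2 rfl
  have h2 : MapClusterPt x atTop y := by
    have := h1.continuousAt_comp (f := (src : G → UnitSpace G)) continuous_src.continuousAt
    have e : (src : G → UnitSpace G) ∘ (fun i => (y i : G)) = y := funext fun i => src_coe (y i)
    rwa [e, src_coe] at this
  obtain ⟨𝒰, hle, hlim⟩ := mapClusterPt_iff_ultrafilter.1 h2
  have h3 : ∀ᶠ i in (𝒰 : Filter ι), ∃ k ∈ (Set.univ : Set (Fin n)), (y i : G) ∈ B k := by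
    filter_upwards [hlim hU] with i hi
    obtain ⟨k, hk⟩ := Set.mem_iUnion.1 (hcov (y i) ⟨hyY i, hi⟩)
    exact ⟨k, trivial, hk⟩
  -- The ultrafilter selects one of the finitely many bisections; along it the net converges to `g k
  -- ≠ 1`.
  obtain ⟨k, -, hk⟩ := (Ultrafilter.eventually_exists_mem_iff Set.finite_univ).1 h3
  have h4 : Tendsto y 𝒰 (𝓝 x ⊓ 𝓟 {y | (y : G) ∈ B k}) :=
    tendsto_inf.2 ⟨hlim, tendsto_principal.2 hk⟩
  have h5 := (tendsto_coe_of_mem_bisection (hB k).2.1 (hB k).2.2).comp h4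
  exact (hB k).1 ((hy (g k)).1 (mapClusterPt_iff_ultrafilter.2 ⟨𝒰, hle, h5⟩))

end Approach

/-! ### Positivity under representations, and the choice of finite subsets -/

section Positivity

/-- Representations commute with the functional calculus, so `π a⁻ = (π a)⁻`. This turns positivity
into a statement about kernels, the language of weak containment. -/
theorem map_nonneg_iff_map_negPart_eq_zero {A : Type*} [NonUnitalCStarAlgebra A] {H : Type*}
    [NormedAddCommGroup H] [InnerProductSpace ℂ H] [CompleteSpace H]
    (π : A →⋆ₙₐ[ℂ] (H →L[ℂ] H)) {a : A} (ha : IsSelfAdjoint a) : 0 ≤ π a ↔ π a⁻ = 0 := by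
  have hπ : IsSelfAdjoint (π a) := ha.map π
  have hcont : Continuous π := by
    refine AddMonoidHomClass.continuous_of_bound π 1 fun b => ?_
    rw [one_mul]
    exact NonUnitalStarAlgHom.norm_apply_le π b
  have h1 : π a⁻ = (π a)⁻ := by
    rw [CFC.negPart_def, CFC.negPart_def]
    exact NonUnitalStarAlgHom.map_cfcₙ (R := ℝ) (S := ℂ) π _ a
      (by fun_prop) (by simp) hcont ha hπ
  rw [h1, CFC.negPart_eq_zero_iff (π a) hπ]

theorem norm_sq_eq_tsum {ι : Type*} (ξ : lp (fun _ : ι => ℂ) 2) :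
    HasSum (fun i => ‖ξ i‖ ^ 2) (‖ξ‖ ^ 2) := by
  have h := lp.hasSum_norm (p := 2) (by norm_num) ξ
  simpa using h

theorem norm_sq_le_sum_norm_sq {ι α : Type*} (F : Finset α) (ξ : lp (fun _ : ι => ℂ) 2)
    (η : α → lp (fun _ : ι => ℂ) 2) (h : ∀ i, ‖ξ i‖ ^ 2 ≤ ∑ a ∈ F, ‖η a i‖ ^ 2) :
    ‖ξ‖ ^ 2 ≤ ∑ a ∈ F, ‖η a‖ ^ 2 :=
  hasSum_le h (norm_sq_eq_tsum ξ) (hasSum_sum fun a _ => norm_sq_eq_tsum (η a))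

/-- Finite subgroups are taken whole; an infinite one is replaced by `N` of its elements, at a cost
of `1/N`. -/
theorem exists_finsets_of_fewCyclicSubgroups {Γ : Type*} [Group Γ] (hfew : FewCyclicSubgroups Γ)
    (F : Finset (Subgroup Γ)) (hF : ∀ C ∈ F, IsCyclic C ∧ C ≠ ⊥) :
    ∃ S : Subgroup Γ → Finset Γ, (∀ C, (S C).Nonempty ∧ (S C : Set Γ) ⊆ C) ∧
      ∑ C ∈ F, (1 : ℝ) / (S C).card < 1 := by
  classical
  have h1 := hfew F hF
  -- This `N` makes the total error, at most `F.card / N`, smaller than the gap left by the strict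
  -- inequality.
  obtain ⟨N, hN⟩ := exists_nat_gt ((F.card : ℝ) / (1 - ∑ C ∈ F, (1 : ℝ) / (Nat.card C : ℝ)))
  have hpos : 0 < 1 - ∑ C ∈ F, (1 : ℝ) / (Nat.card C : ℝ) := by linarith
  have hN0 : (0 : ℝ) < N := lt_of_le_of_lt (by positivity) hN
  have hS : ∀ C : Subgroup Γ, ∃ T : Finset Γ, (T.Nonempty ∧ (T : Set Γ) ⊆ C) ∧
      (1 : ℝ) / T.card ≤ 1 / (Nat.card C : ℝ) + 1 / N := by
    intro C
    by_cases hC : (C : Set Γ).Finite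
    · refine ⟨hC.toFinset, ⟨⟨1, by simp [C.one_mem]⟩, by simp⟩, ?_⟩
      have h2 : Nat.card C = hC.toFinset.card := Nat.card_eq_card_finite_toFinset hC
      rw [h2]
      exact le_add_of_nonneg_right (by positivity)
    · obtain ⟨T, hT, hcard⟩ := Set.Infinite.exists_subset_card_eq hC N
      refine ⟨T, ⟨Finset.card_pos.1 ?_, hT⟩, ?_⟩
      · rw [hcard]
        exact_mod_cast hN0
      · rw [hcard]
        exact le_add_of_nonneg_left (by positivity)
  choose S hS1 hS2 using hS
  refine ⟨S, hS1, ?_⟩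
  calc ∑ C ∈ F, (1 : ℝ) / (S C).card ≤ ∑ C ∈ F, (1 / (Nat.card C : ℝ) + 1 / N) :=
        Finset.sum_le_sum fun C _ => hS2 C
    _ = ∑ C ∈ F, 1 / (Nat.card C : ℝ) + F.card / N := by
        rw [Finset.sum_add_distrib, Finset.sum_const, nsmul_eq_mul, mul_one_div]
    _ < 1 := by
        rw [div_lt_iff₀ hpos] at hN
        have h3 : (F.card : ℝ) / N < 1 - ∑ C ∈ F, (1 : ℝ) / (Nat.card C : ℝ) := by
          rw [div_lt_iff₀ hN0]
          linarith
        linarith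

end Positivity

/-! ### Failure of weak containment under (*) -/

section Covered
variable {G : Type u} [TopologicalSpace G] [ArrowGroupoid G] [IsLocallyCompactEtale G]
variable {Y : Set (UnitSpace G)} {x : UnitSpace G}

/-- `f ↦ ρ_y(f)` as a linear map. -/
def rhoCcLinear (y : UnitSpace G) : Cc G →ₗ[ℂ] HilbertFiber y →L[ℂ] HilbertFiber y where
  toFun := rhoCc y
  map_add' f₁ f₂ := congrArg (fun a : OperatorProduct G => a.1 y) (rhoFamily_add f₁ f₂)
  map_smul' c f := congrArg (fun a : OperatorProduct G => a.1 y) (rhoFamily_smul c f)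

theorem norm_sum_delta_sq {y : UnitSpace G} (T : Finset (SourceFiber y)) :
    ‖∑ k ∈ T, delta k‖ ^ 2 = T.card := by
  classical
  have h := lp.norm_sum_single (p := 2) (by norm_num) (fun _ : SourceFiber y => (1 : ℂ)) T
  have h2 : ∑ k ∈ T, delta k = ∑ k ∈ T, lp.single 2 k (1 : ℂ) := by
    refine Finset.sum_congr rfl fun k _ => ?_
    unfold delta
    congr!
  rw [h2]
  simpa using h

/-- The element `a = ∑ f_i* f_i - f₀* f₀` is positive in each `ρ_y`, `y ∈ Y`, so the direct sum
kills `a⁻`. Weak containment would make `ρ_x(a)` positive, against its value at `ξ₀`. -/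
theorem not_weaklyContained_of_norm_sq_lt {α : Type*} (F : Finset α) (f : α → Cc G) (f₀ : Cc G)
    (hY : ∀ y ∈ Y, ∀ ξ, ‖rhoCc y f₀ ξ‖ ^ 2 ≤ ∑ i ∈ F, ‖rhoCc y (f i) ξ‖ ^ 2)
    {ξ₀ : HilbertFiber x} (hx : ∑ i ∈ F, ‖rhoCc x (f i) ξ₀‖ ^ 2 < ‖rhoCc x f₀ ξ₀‖ ^ 2) :
    ¬ WeaklyContained (rho x) (directSum fun y : Y => rho (y : UnitSpace G)) := by
  intro hw
  let a : ReducedCStarAlgebra G :=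
    ∑ i ∈ F, star (ofCc (f i)) * ofCc (f i) - star (ofCc f₀) * ofCc f₀
  have ha : IsSelfAdjoint a := by
    refine IsSelfAdjoint.sub ?_ (IsSelfAdjoint.star_mul_self _)
    exact isSelfAdjoint_sum F fun i _ => IsSelfAdjoint.star_mul_self _
  have hform : ∀ (y : UnitSpace G) (ξ : HilbertFiber y), (rho y a).reApplyInnerSelf ξ =
      ∑ i ∈ F, ‖rhoCc y (f i) ξ‖ ^ 2 - ‖rhoCc y f₀ ξ‖ ^ 2 := by
    intro y ξ
    have h1 : ∀ f : Cc G, inner ℂ (rho y (star (ofCc f) * ofCc f) ξ) ξ =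
        ((‖rhoCc y f ξ‖ ^ 2 : ℝ) : ℂ) := fun f => by
      rw [map_mul, map_star, rho_ofCc, ContinuousLinearMap.star_eq_adjoint]
      change inner ℂ (ContinuousLinearMap.adjoint (rhoCc y f) (rhoCc y f ξ)) ξ = _
      rw [ContinuousLinearMap.adjoint_inner_left, inner_self_eq_norm_sq_to_K]
      simp
    rw [ContinuousLinearMap.reApplyInnerSelf_apply]
    simp only [a, map_sub, map_sum, sub_apply, sum_apply,
      inner_sub_left, sum_inner, h1, RCLike.re_eq_complex_re,
      Complex.ofReal_re]
  have hpos : ∀ y : UnitSpace G, 0 ≤ rho y a ↔ ∀ ξ, 0 ≤ (rho y a).reApplyInnerSelf ξ := by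
    intro y
    rw [ContinuousLinearMap.nonneg_iff_isPositive, ContinuousLinearMap.isPositive_def']
    exact and_iff_right (ha.map (rho y))
  have h1 : directSum (fun y : Y => rho (y : UnitSpace G)) a⁻ = 0 := by
    rw [directSum_eq_zero_iff]
    intro y
    rw [← map_nonneg_iff_map_negPart_eq_zero (rho (y : UnitSpace G)) ha, hpos]
    intro ξ
    rw [hform]
    exact sub_nonneg.2 (hY y y.2 ξ)
  have h2 := (hpos x).1 ((map_nonneg_iff_map_negPart_eq_zero (rho x) ha).2 (hw _ h1)) ξ₀
  rw [hform] at h2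
  linarith

/-- If the unit `rng k` lies in `B`, it is the only arrow of `B` with that range, so only `l = k`
contributes: in this coordinate a bump on `B` acts as if it lived on the unit space. -/
theorem rhoCc_bisectionLift_apply {B : Set G} (hB : IsOpenBisection B) {φ : UnitSpace G → ℝ}
    {f : Cc G} (hf : (f : G → ℂ) = bisectionLift B φ) {y : UnitSpace G} (ξ : HilbertFiber y)
    {k : SourceFiber y} (hk : ((rng k.1 : UnitSpace G) : G) ∈ B) :
    rhoCc y f ξ k = φ (rng k.1) * ξ k := by
  rw [rhoCc_apply, hf, tsum_eq_single k]
  · have h1 : k.1 * k.1⁻¹ = ((rng k.1 : UnitSpace G) : G) := mul_inv_self k.1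
    unfold bisectionLift
    rw [h1, if_pos hk, src_coe]
  · intro l hl
    unfold bisectionLift
    rw [if_neg, zero_mul]
    intro hmem
    have h1 : k.1 * l.1⁻¹ = ((rng k.1 : UnitSpace G) : G) :=
      hB.2.2 hmem hk (by rw [rng_mul (src_div k l), rng_coe])
    refine hl (Subtype.ext ?_)
    have h2 := arrow_inv_mul_cancel_right (k.2.trans l.2.symm)
    have h3 : rng k.1 = rng l.1 := by
      rw [← src_coe (rng k.1), ← h1, src_mul (src_div k l), src_inv]
    rw [h1, h3] at h2
    exact (range_mul_self l.1).symm.trans h2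

theorem not_weaklyContained_of_coveredNear (hY : GroupoidInvariant Y)
    (hfew : FewCyclicSubgroups (Isotropy x)) (h : CoveredNear Y x) :
    ¬ WeaklyContained (rho x) (directSum fun y : Y => rho (y : UnitSpace G)) := by
  classical
  obtain ⟨n, -, g, B, U, hB, hU, hcov⟩ := h
  -- Passing to the image merges the `g j` that generate the same subgroup, as the hypothesis only
  -- bounds sums over distinct subgroups.
  let F : Finset (Subgroup (Isotropy x)) := Finset.univ.image fun j => Subgroup.zpowers (g j)
  obtain ⟨S, hS, hsum⟩ := exists_finsets_of_fewCyclicSubgroups hfew F (by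
    intro C hC
    obtain ⟨j, -, rfl⟩ := Finset.mem_image.1 hC
    exact ⟨inferInstance, fun h0 => (hB j).1 (Subgroup.zpowers_eq_bot.1 h0)⟩)
  choose D hD hgD using fun h : Isotropy x => exists_isOpenBisection (h : G)
  let T : Finset (Isotropy x) := F.biUnion S
  -- The second condition allows a bump supported in `W` to be lifted to each `D h`; the third
  -- transfers membership in `B j` to the bisections around the chosen powers of `g j`.
  let W : Set (UnitSpace G) := {y | y ∈ U ∧ (∀ h ∈ T, y ∈ src '' D h) ∧
    ∀ j, ∀ h ∈ S (Subgroup.zpowers (g j)), (y : G) ∈ B j → (y : G) ∈ D h}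
  have hW : W ∈ 𝓝 x := by
    have h1 : ∀ᶠ y in 𝓝 x, ∀ h ∈ T, y ∈ src '' D h :=
      (Finset.eventually_all T).2 fun h _ =>
        (isOpenMap_src _ (hD h).1).mem_nhds ⟨h, hgD h, h.2.1⟩
    have h2 : ∀ᶠ y in 𝓝 x, ∀ j, ∀ h ∈ S (Subgroup.zpowers (g j)),
        ((y : UnitSpace G) : G) ∈ B j → (y : G) ∈ D h := by
      refine eventually_all.2 fun j => (Finset.eventually_all _).2 fun h hh => ?_
      have h3 := tendsto_coe_of_mem_zpowers inf_le_left
        (tendsto_coe_of_mem_bisection (hB j).2.1 (hB j).2.2) ((hS _).2 hh)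
      exact eventually_inf_principal.1 (h3 ((hD h).1.mem_nhds (hgD h)))
    filter_upwards [hU, h1, h2] with y h1 h2 h3 using ⟨h1, h2, h3⟩
  obtain ⟨φ, hφ, hc, hs, hφx⟩ := exists_bump hW
  have hψ : ∀ h ∈ T, ∃ f : Cc G, (f : G → ℂ) = bisectionLift (D h) φ := fun h hh =>
    ⟨⟨_, (isBisectionFunction_bisectionLift (hD h) hφ hc
      fun y hy => (hs hy).2.1 h hh).mem_Cc (hD h)⟩, rfl⟩
  choose! ψ hψ using hψ
  have hunits := isOpenBisection_units (G := G)
  obtain ⟨f₀, hf₀⟩ : ∃ f : Cc G, (f : G → ℂ) = bisectionLift {g : G | source g = g} φ :=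
    ⟨⟨_, (isBisectionFunction_bisectionLift hunits hφ hc
      fun y _ => ⟨y, y.2, src_coe y⟩).mem_Cc hunits⟩, rfl⟩
  let f : Subgroup (Isotropy x) → Cc G := fun C => ((S C).card : ℂ)⁻¹ • ∑ h ∈ S C, ψ h
  have hf : ∀ C y, rhoCc y (f C) = ((S C).card : ℂ)⁻¹ • ∑ h ∈ S C, rhoCc y (ψ h) := fun C y => by
    change rhoCcLinear y (f C) = _
    simp only [f, map_smul, map_sum]
    rfl
  have hcard : ∀ C, ((S C).card : ℂ) ≠ 0 := fun C => by
    exact_mod_cast (Finset.card_pos.2 (hS C).1).ne'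
  have hT : ∀ C ∈ F, ∀ h ∈ S C, h ∈ T := fun C hC h hh => Finset.mem_biUnion.2 ⟨C, hC, hh⟩
  refine not_weaklyContained_of_norm_sq_lt F f f₀ (fun y hy ξ => ?_) (ξ₀ := delta (unitFiber x)) ?_
  · refine norm_sq_le_sum_norm_sq F _ _ fun k => ?_
    have h1 : rhoCc y f₀ ξ k = φ (rng k.1) * ξ k :=
      rhoCc_bisectionLift_apply hunits hf₀ ξ (rng k.1).2
    by_cases h0 : φ (rng k.1) = 0
    · rw [h1, h0]
      simp only [Complex.ofReal_zero, zero_mul, norm_zero, zero_pow two_ne_zero]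
      exact Finset.sum_nonneg fun C _ => by positivity
    · have hkW : rng k.1 ∈ W := hs (subset_tsupport _ h0)
      have hkY : rng k.1 ∈ Y := (hY k.1).1 (by rwa [k.2])
      obtain ⟨j, hj⟩ := Set.mem_iUnion.1 (hcov _ ⟨hkY, hkW.1⟩)
      have hC : Subgroup.zpowers (g j) ∈ F := Finset.mem_image_of_mem _ (Finset.mem_univ j)
      -- Every term of the average equals `φ (rng k) * ξ k`, so this one subgroup already dominates
      -- the `f₀` coordinate.
      have h2 : rhoCc y (f (Subgroup.zpowers (g j))) ξ k = rhoCc y f₀ ξ k := by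
        rw [hf, h1]
        have h3 : (((S (Subgroup.zpowers (g j))).card : ℂ)⁻¹ •
            ∑ h ∈ S (Subgroup.zpowers (g j)), rhoCc y (ψ h)) ξ k =
            ((S (Subgroup.zpowers (g j))).card : ℂ)⁻¹ *
              ∑ h ∈ S (Subgroup.zpowers (g j)), rhoCc y (ψ h) ξ k := by
          rw [smul_apply, sum_apply, lp.coeFn_smul,
            Pi.smul_apply, lp.coeFn_sum, Finset.sum_apply, smul_eq_mul]
        rw [h3, Finset.sum_congr rfl fun h hh => rhoCc_bisectionLift_apply (hD h)
          (hψ h (hT _ hC h hh)) ξ (hkW.2.2 j h hh hj), Finset.sum_const, nsmul_eq_mul,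
          inv_mul_cancel_left₀ (hcard _)]
      rw [← h2]
      exact Finset.single_le_sum (f := fun C => ‖rhoCc y (f C) ξ k‖ ^ 2)
        (fun C _ => by positivity) hC
  · let e : Isotropy x ↪ SourceFiber x :=
      ⟨fun h => ⟨h.1, h.2.1⟩, fun h h' he => Subtype.ext (congrArg (fun k : SourceFiber x => k.1) he)⟩
    -- At `x` the terms separate: the average of `|S C|` orthonormal vectors has squared norm `1/|S
    -- C|`.
    have h1 : ∀ C ∈ F, ‖rhoCc x (f C) (delta (unitFiber x))‖ ^ 2 = 1 / ((S C).card : ℝ) := by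
      intro C hC
      have h2 : rhoCc x (f C) (delta (unitFiber x)) =
          ((S C).card : ℂ)⁻¹ • ∑ k ∈ (S C).map e, delta k := by
        rw [hf, smul_apply, sum_apply, Finset.sum_map]
        congr 1
        exact Finset.sum_congr rfl fun h hh =>
          rhoCc_bisectionLift_delta_unit (hD h) (hψ h (hT C hC h hh)) hφx (k := e h) (hgD h)
      rw [h2, norm_smul, mul_pow, norm_sum_delta_sq, Finset.card_map, norm_inv, Complex.norm_natCast]
      have : ((S C).card : ℝ) ≠ 0 := by exact_mod_cast hcard C
      field_simp
    rw [Finset.sum_congr rfl h1, rhoCc_bisectionLift_delta_unit hunits hf₀ hφx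
      (k := unitFiber x) x.2, norm_delta, one_pow]
    exact hsum

end Covered
end EtaleGroupoid
end

theorem corollary1p9 {G : Type u} [TopologicalSpace G] [ArrowGroupoid G] [IsLocallyCompactEtale G]
    (Y : Set (UnitSpace G)) (hY : GroupoidInvariant Y)
    (x : UnitSpace G) (hx : x ∈ closure Y) (hxY : x ∉ Y)
    (hfew : FewCyclicSubgroups (Isotropy x)) :
    (WeaklyContained (rho x) (directSum fun y : Y => rho (y : UnitSpace G)) ↔ ¬ CoveredNear Y x) ∧
      (¬ CoveredNear Y x ↔ ExistsNetUniqueAcc Y x) := by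
  refine ⟨⟨fun hw hc => not_weaklyContained_of_coveredNear hY hfew hc hw, fun hc => ?_⟩,
    fun hc => ?_, not_coveredNear_of_existsNetUniqueAcc⟩
  · obtain ⟨l, hl⟩ := exists_approachFilter hx hc
    exact hl.weaklyContained
  · obtain ⟨l, hl⟩ := exists_approachFilter hx hc
    exact hl.existsNetUniqueAcc
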